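/- Algebras are associative unital $\mathbb C$-algebras; algebra homomorphisms are unital. An Arens–Michael algebra is a complete Hausdorff locally convex algebra whose topology is generated by submultiplicative seminorms. For an Arens–Michael algebra $A$, an $A$-$\hat\otimes$-bimodule is a complete Hausdorff locally convex space with an $A$-bimodule structure whose two actions are jointly continuous; "Fréchet" means in addition metrizable. $M\hat\otimes_A N$ is the completion of $M\otimes_A N$ in the projective topology. Two $A$-$\hat\otimes$-bimodules $M$, $M^{-1}$ are topologically inverse if they are given together with topological isomorphisms of $A$-bimodules $i_1:M\hat\otimes_A M^{-1}\to A$ and $i_2:M^{-1}\hat\otimes_A M\to A$ such that $i_1(x\otimes y)\,x'=x\,i_2(y\otimes x')$ and $i_2(y\otimes x)\,y'=y\,i_1(x\otimes y')$ for all $x,x'\in M$, $y,y'\in M^{-1}$. A topologically compatible triple $(\theta,\alpha,\beta)$ into an Arens–Michael algebra $B$ consists of a continuous algebra homomorphism $\theta:A\to B$ and continuous $A$-bimodule homomorphisms $\alpha:M\to B$, $\beta:M^{-1}\to B$ ($A$ acting on $B$ through $\theta$) with $\alpha(x)\beta(y)=\theta(i_1(x\otimes y))$ and $\beta(y)\alpha(x)=\theta(i_2(y\otimes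 x))$ for all $x\in M$, $y\in M^{-1}$. For an $A$-$\hat\otimes$-bimodule $P$, the analytic tensor algebra is the locally convex space $$\widehat T_A(P)=A\oplus\Big\{(x_n)_{n\ge1}\in\prod_{n\ge1}P^{\hat\otimes_A n}:\ \|(x_n)\|_{p,\rho}:=\sum_{n\ge1}p^{\hat\otimes n}(x_n)\rho^n<\infty\ \text{ for all continuous seminorms } p \text{ on } P \text{ and all } \rho>0\Big\},$$ the second summand being topologized by the seminorms $\|\cdot\|_{p,\rho}$. Theorem. Let $A$ be a Fréchet Arens–Michael algebra and let $M$, $M^{-1}$ be topologically inverse Fréchet $A$-$\hat\otimes$-bimodules. Then: (1) $\widehat T_A(M\oplus M^{-1})$ carries a multiplication which makes it an Arens–Michael algebra and for which the natural inclusion of the algebraic tensor algebra $T_A(M\oplus M^{-1})$ is an algebra homomorphism. (2) Let $I$ be the closure of the two-sided ideal of $\widehat T_A(M\oplus M^{-1})$ generated by the elements $(x,0)\otimes(0,y)-i_1(x\otimes y)$ and $(0,y)\otimes(x,0)-i_2(y\otimes x)$, $x\in M$, $y\in M^{-1}$. Then $\widehat L_A(M):=\widehat T_A(M\oplus M^{-1})/I$,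 with the quotient topology, is an Arens–Michael algebra, and the maps $\theta,\alpha,\beta$ from $A$, $M$, $M^{-1}$ to $\widehat L_A(M)$ induced by the natural inclusions into $\widehat T_A(M\oplus M^{-1})$ form a topologically compatible triple. (3) This triple is universal: for every Arens–Michael algebra $B$ and every topologically compatible triple $(\theta',\alpha',\beta')$ into $B$ there is a unique continuous algebra homomorphism $f:\widehat L_A(M)\to B$ with $f\circ\theta=\theta'$, $f\circ\alpha=\alpha'$ and $f\circ\beta=\beta'$. -/

import Mathlib

open scoped TensorProduct Topology MulOpposite

noncomputable section

/-! ## Seminorms and the uniform structures they generate -/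

namespace HatTensor

section Seminorms

variable {E X ι : Type*} [AddCommGroup E] [Module ℂ E]

/-- Values `∑ |f x| c x` over all representations `z = ∑ f x • t x`. -/
def costSet (t : X → E) (c : X → ℝ) (z : E) : Set ℝ :=
  {r | ∃ f : X →₀ ℂ, Finsupp.linearCombination ℂ t f = z ∧ f.sum (fun x a => ‖a‖ * c x) = r}

/-- The seminorm `z ↦ inf {∑ |f x| c x : z = ∑ f x • t x}` attached to a spanning family `t`
and nonnegative weights `c`. If the `t x` are the elementary tensors and the `c x` the products
of the seminorms of their factors, this is the projective tensor seminorm. -/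
def infSeminorm (t : X → E) (c : X → ℝ) (hc : ∀ x, 0 ≤ c x)
    (ht : Submodule.span ℂ (Set.range t) = ⊤) : Seminorm ℂ E :=
  have bdd : ∀ z, BddBelow (costSet t c z) := fun z => ⟨0, by
    rintro r ⟨f, -, rfl⟩
    exact Finset.sum_nonneg fun x _ => mul_nonneg (norm_nonneg _) (hc x)⟩
  have ne : ∀ z, (costSet t c z).Nonempty := fun z => by
    have hz : z ∈ Submodule.span ℂ (Set.range t) := ht ▸ Submodule.mem_top
    obtain ⟨f, hf⟩ := (Finsupp.mem_span_range_iff_exists_finsupp).1 hz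
    exact ⟨_, f, hf, rfl⟩
  Seminorm.ofSMulLE (fun z => sInf (costSet t c z))
    (by
      refine le_antisymm (csInf_le (bdd 0) ⟨0, by simp, by simp⟩) (le_csInf (ne 0) ?_)
      rintro r ⟨f, -, rfl⟩
      exact Finset.sum_nonneg fun x _ => mul_nonneg (norm_nonneg _) (hc x))
    (by
      intro z w
      have key : ∀ a ∈ costSet t c z, ∀ b ∈ costSet t c w,
          sInf (costSet t c (z + w)) ≤ a + b := by
        classical
        rintro a ⟨f, hf, rfl⟩ b ⟨g, hg, rfl⟩
        refine (csInf_le (bdd _) ⟨f + g, by rw [map_add, hf, hg], rfl⟩).trans ?_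
        rw [Finsupp.sum_of_support_subset (f + g) Finsupp.support_add _ (by simp),
          Finsupp.sum_of_support_subset f (Finset.subset_union_left (s₂ := g.support)) _ (by simp),
          Finsupp.sum_of_support_subset g (Finset.subset_union_right (s₁ := f.support)) _
            (by simp), ← Finset.sum_add_distrib]
        refine Finset.sum_le_sum fun x _ => ?_
        rw [← add_mul]
        exact mul_le_mul_of_nonneg_right (norm_add_le _ _) (hc x)
      have h1 : ∀ a ∈ costSet t c z,
          sInf (costSet t c (z + w)) - a ≤ sInf (costSet t c w) := fun a ha =>
        le_csInf (ne w) fun b hb => by linarith [key a ha b hb]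
      have h2 : sInf (costSet t c (z + w)) - sInf (costSet t c w) ≤ sInf (costSet t c z) :=
        le_csInf (ne z) fun a ha => by linarith [h1 a ha]
      linarith)
    (by
      intro r z
      have key : ∀ a ∈ costSet t c z, sInf (costSet t c (r • z)) ≤ ‖r‖ * a := by
        rintro a ⟨f, hf, rfl⟩
        refine csInf_le (bdd _) ⟨r • f, by rw [map_smul, hf], ?_⟩
        rw [Finsupp.sum_smul_index (by simp), Finsupp.mul_sum]
        simp [mul_assoc]
      rcases (norm_nonneg r).eq_or_lt with h | h
      · obtain ⟨a, ha⟩ := ne z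
        simpa [← h] using key a ha
      · have : ‖r‖⁻¹ * sInf (costSet t c (r • z)) ≤ sInf (costSet t c z) :=
          le_csInf (ne z) fun a ha => by
            rw [inv_mul_le_iff₀ h]
            exact key a ha
        rwa [inv_mul_le_iff₀ h] at this)

/-- The coarsest uniform structure for which all seminorms of the family are uniformly
continuous, i.e. the one of the locally convex topology generated by the family. -/
abbrev seminormUniformSpace (p : ι → Seminorm ℂ E) : UniformSpace E :=
  ⨅ i, (p i).toAddGroupSeminorm.toSeminormedAddCommGroup.toUniformSpace

theorem isUniformAddGroup_seminorm (p : ι → Seminorm ℂ E) :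
    @IsUniformAddGroup E (seminormUniformSpace p) _ :=
  isUniformAddGroup_iInf fun i =>
    (p i).toAddGroupSeminorm.toSeminormedAddCommGroup.to_isUniformAddGroup

theorem withSeminorms_seminorm (p : ι → Seminorm ℂ E) :
    @WithSeminorms ℂ E ι _ _ _ p (seminormUniformSpace p).toTopologicalSpace := by
  let _ := seminormUniformSpace p
  have := isUniformAddGroup_seminorm p
  exact (SeminormFamily.withSeminorms_iff_uniformSpace_eq_iInf p).2 rfl

theorem uniformContinuousConstSMul_seminorm (p : ι → Seminorm ℂ E) :
    @UniformContinuousConstSMul ℂ E (seminormUniformSpace p) _ := by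
  let _ := seminormUniformSpace p
  have := isUniformAddGroup_seminorm p
  have := (withSeminorms_seminorm p).continuousSMul
  exact uniformContinuousConstSMul_of_continuousConstSMul ℂ E

/-- The continuous extension of a continuous seminorm to the completion. -/
def completionSeminorm [UniformSpace E] [IsUniformAddGroup E] [UniformContinuousConstSMul ℂ E]
    (p : Seminorm ℂ E) (hp : Continuous p) : Seminorm ℂ (UniformSpace.Completion E) :=
  have hu : UniformContinuous p :=
    Seminorm.uniformContinuous_of_continuousAt_zero hp.continuousAt
  have hc : Continuous (UniformSpace.Completion.extension p) :=
    UniformSpace.Completion.continuous_extension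
  have he : ∀ x : E, UniformSpace.Completion.extension p (x : UniformSpace.Completion E) = p x :=
    UniformSpace.Completion.extension_coe hu
  Seminorm.of (UniformSpace.Completion.extension p)
    (fun x y => by
      refine UniformSpace.Completion.induction_on₂ x y (isClosed_le ?_ ?_) fun a b => ?_
      · exact hc.comp (continuous_fst.add continuous_snd)
      · exact (hc.comp continuous_fst).add (hc.comp continuous_snd)
      · rw [← UniformSpace.Completion.coe_add, he, he, he]
        exact map_add_le_add p a b)
    (fun r x => by
      refine UniformSpace.Completion.induction_on x (isClosed_eq ?_ ?_) fun a => ?_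
      · exact hc.comp (continuous_const_smul r)
      · exact continuous_const.mul hc
      · rw [← UniformSpace.Completion.coe_smul, he, he, map_smul_eq_mul])

end Seminorms

end HatTensor

/-! ## Arens–Michael algebras and `⊗̂`-bimodules -/

/-- A (unital, complex) Arens–Michael algebra: a complete Hausdorff locally convex algebra whose
topology is generated by a family of submultiplicative seminorms. -/
class ArensMichaelAlgebra (A : Type*) [Ring A] [Algebra ℂ A] [UniformSpace A] : Prop
    extends IsUniformAddGroup A, CompleteSpace A, T2Space A where
  exists_submultiplicative : ∃ P : Set (Seminorm ℂ A),
    (∀ p ∈ P, ∀ a b : A, p (a * b) ≤ p a * p b) ∧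
      WithSeminorms (fun p : P => (p : Seminorm ℂ A))

/-- An `A`-`⊗̂`-bimodule: a complete Hausdorff locally convex space with a structure of an
`A`-bimodule (over the complex algebra `A`) such that both actions are jointly continuous.
The right action is written as the left action of `Aᵐᵒᵖ`. -/
class HatBimodule (A M : Type*) [Ring A] [Algebra ℂ A] [UniformSpace A]
    [AddCommGroup M] [Module ℂ M] [Module A M] [Module Aᵐᵒᵖ M] [UniformSpace M] : Prop where
  isUniformAddGroup : IsUniformAddGroup M
  completeSpace : CompleteSpace M
  t2Space : T2Space M
  continuousSMul : ContinuousSMul ℂ M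
  locallyConvex : PolynormableSpace ℂ M
  isScalarTower_left : IsScalarTower ℂ A M
  isScalarTower_right : IsScalarTower ℂ Aᵐᵒᵖ M
  smulCommClass : SMulCommClass A Aᵐᵒᵖ M
  continuousSMul_left : ContinuousSMul A M
  continuousSMul_right : ContinuousSMul Aᵐᵒᵖ M

namespace HatTensor

/-! ## The completed projective tensor product `M ⊗̂_A N` -/

section Binary

variable (A M N : Type*) [Ring A]
  [AddCommGroup M] [Module ℂ M] [Module Aᵐᵒᵖ M] [TopologicalSpace M]
  [AddCommGroup N] [Module ℂ N] [Module A N] [TopologicalSpace N]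

/-- The subspace of `M ⊗_ℂ N` spanned by all `xa ⊗ y - x ⊗ ay`. -/
def balanceRel : Submodule ℂ (M ⊗[ℂ] N) :=
  Submodule.span ℂ {z | ∃ (x : M) (a : A) (y : N),
    z = (MulOpposite.op a • x) ⊗ₜ[ℂ] y - x ⊗ₜ[ℂ] (a • y)}

/-- The algebraic tensor product `M ⊗_A N`. -/
def BalancedTensor : Type _ := (M ⊗[ℂ] N) ⧸ balanceRel A M N

instance : AddCommGroup (BalancedTensor A M N) :=
  inferInstanceAs (AddCommGroup ((M ⊗[ℂ] N) ⧸ balanceRel A M N))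

instance : Module ℂ (BalancedTensor A M N) :=
  inferInstanceAs (Module ℂ ((M ⊗[ℂ] N) ⧸ balanceRel A M N))

variable {M N} in
/-- The elementary tensor `x ⊗ y` in `M ⊗_A N`. -/
def BalancedTensor.tmul (x : M) (y : N) : BalancedTensor A M N :=
  (balanceRel A M N).mkQ (x ⊗ₜ[ℂ] y)

theorem BalancedTensor.span_tmul :
    Submodule.span ℂ (Set.range fun z : M × N => BalancedTensor.tmul A z.1 z.2) = ⊤ := by
  have h : (Set.range fun z : M × N => BalancedTensor.tmul A z.1 z.2) =
      (balanceRel A M N).mkQ '' {t | ∃ m n, m ⊗ₜ[ℂ] n = t} := by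
    ext w
    constructor
    · rintro ⟨⟨x, y⟩, rfl⟩
      exact ⟨_, ⟨x, y, rfl⟩, rfl⟩
    · rintro ⟨_, ⟨x, y, rfl⟩, rfl⟩
      exact ⟨(x, y), rfl⟩
  rw [h]
  refine (Submodule.map_span (balanceRel A M N).mkQ _).symm.trans ?_
  rw [TensorProduct.span_tmul_eq_top, Submodule.map_top]
  exact Submodule.range_mkQ _

variable {M N} in
/-- The projective tensor seminorm
`(p ⊗ q)(z) = inf {∑ᵢ p(xᵢ) q(yᵢ) : z = ∑ᵢ xᵢ ⊗ yᵢ}` on `M ⊗_A N`. -/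
def BalancedTensor.seminorm (p : Seminorm ℂ M) (q : Seminorm ℂ N) :
    Seminorm ℂ (BalancedTensor A M N) :=
  infSeminorm (fun z : M × N => BalancedTensor.tmul A z.1 z.2) (fun z => p z.1 * q z.2)
    (fun z => mul_nonneg (apply_nonneg p z.1) (apply_nonneg q z.2))
    (BalancedTensor.span_tmul A M N)

/-- The seminorms `p ⊗ q`, with `p` and `q` running through all continuous seminorms. -/
def BalancedTensor.family
    (i : {p : Seminorm ℂ M // Continuous p} × {q : Seminorm ℂ N // Continuous q}) :
    Seminorm ℂ (BalancedTensor A M N) :=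
  BalancedTensor.seminorm A i.1.1 i.2.1

instance : UniformSpace (BalancedTensor A M N) :=
  seminormUniformSpace (BalancedTensor.family A M N)

instance : IsUniformAddGroup (BalancedTensor A M N) :=
  isUniformAddGroup_seminorm (BalancedTensor.family A M N)

instance : UniformContinuousConstSMul ℂ (BalancedTensor A M N) :=
  uniformContinuousConstSMul_seminorm (BalancedTensor.family A M N)

/-- `M ⊗̂_A N`: the (Hausdorff) completion of `M ⊗_A N` in the projective topology. -/
abbrev CompletedTensor : Type _ := UniformSpace.Completion (BalancedTensor A M N)

variable {M N} in
/-- The elementary tensor `x ⊗ y` in `M ⊗̂_A N`. -/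
def CompletedTensor.tmul (x : M) (y : N) : CompletedTensor A M N :=
  ((BalancedTensor.tmul A x y : BalancedTensor A M N) : CompletedTensor A M N)

end Binary

/-! ## The completed tensor powers `M ⊗̂_A ⋯ ⊗̂_A M` -/

section Power

variable (A M : Type*) [Ring A]
  [AddCommGroup M] [Module ℂ M] [Module A M] [Module Aᵐᵒᵖ M] [TopologicalSpace M]

/-- The subspace of `M ⊗_ℂ ⋯ ⊗_ℂ M` (`n` factors) spanned by all
`⋯ ⊗ xᵢ a ⊗ xᵢ₊₁ ⊗ ⋯ - ⋯ ⊗ xᵢ ⊗ a xᵢ₊₁ ⊗ ⋯`. -/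
def powerRel (n : ℕ) : Submodule ℂ (⨂[ℂ]^n M) :=
  Submodule.span ℂ {z | ∃ (x : Fin n → M) (a : A) (i j : Fin n), (j : ℕ) = i + 1 ∧
    z = PiTensorProduct.tprod ℂ (Function.update x i (MulOpposite.op a • x i)) -
      PiTensorProduct.tprod ℂ (Function.update x j (a • x j))}

/-- The algebraic tensor power `M ⊗_A ⋯ ⊗_A M` with `n` factors; used only for `n ≥ 1`. -/
def BalancedPower (n : ℕ) : Type _ := (⨂[ℂ]^n M) ⧸ powerRel A M n

instance (n : ℕ) : AddCommGroup (BalancedPower A M n) :=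
  inferInstanceAs (AddCommGroup ((⨂[ℂ]^n M) ⧸ powerRel A M n))

instance (n : ℕ) : Module ℂ (BalancedPower A M n) :=
  inferInstanceAs (Module ℂ ((⨂[ℂ]^n M) ⧸ powerRel A M n))

variable {M} in
/-- The elementary tensor `x₁ ⊗ ⋯ ⊗ xₙ` over `A`. -/
def BalancedPower.tprod {n : ℕ} (x : Fin n → M) : BalancedPower A M n :=
  (powerRel A M n).mkQ (PiTensorProduct.tprod ℂ x)

theorem BalancedPower.span_tprod (n : ℕ) :
    Submodule.span ℂ (Set.range fun x : Fin n → M => BalancedPower.tprod A x) = ⊤ := by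
  have h : (Set.range fun x : Fin n → M => BalancedPower.tprod A x) =
      (powerRel A M n).mkQ '' Set.range (PiTensorProduct.tprod ℂ) := by
    rw [← Set.range_comp]
    rfl
  rw [h]
  refine (Submodule.map_span (powerRel A M n).mkQ _).symm.trans ?_
  rw [PiTensorProduct.span_tprod_eq_top, Submodule.map_top]
  exact Submodule.range_mkQ _

variable {M} in
/-- The projective tensor power of a seminorm:
`p^{⊗n}(z) = inf {∑ⱼ p(xⱼ₁) ⋯ p(xⱼₙ) : z = ∑ⱼ xⱼ₁ ⊗ ⋯ ⊗ xⱼₙ}` (for `n ≥ 1`). -/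
def BalancedPower.seminorm (p : Seminorm ℂ M) (n : ℕ) : Seminorm ℂ (BalancedPower A M n) :=
  infSeminorm (fun x : Fin n → M => BalancedPower.tprod A x) (fun x => ∏ i, p (x i))
    (fun x => Finset.prod_nonneg fun i _ => apply_nonneg p (x i))
    (BalancedPower.span_tprod A M n)

/-- The seminorms `p^{⊗n}`, with `p` running through all continuous seminorms. They generate the
projective topology: this family of `p` is directed. -/
def BalancedPower.family (n : ℕ) (p : {p : Seminorm ℂ M // Continuous p}) :
    Seminorm ℂ (BalancedPower A M n) :=
  BalancedPower.seminorm A p.1 n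

instance (n : ℕ) : UniformSpace (BalancedPower A M n) :=
  seminormUniformSpace (BalancedPower.family A M n)

instance (n : ℕ) : IsUniformAddGroup (BalancedPower A M n) :=
  isUniformAddGroup_seminorm (BalancedPower.family A M n)

instance (n : ℕ) : UniformContinuousConstSMul ℂ (BalancedPower A M n) :=
  uniformContinuousConstSMul_seminorm (BalancedPower.family A M n)

theorem BalancedPower.continuous_family (n : ℕ) (p : {p : Seminorm ℂ M // Continuous p}) :
    Continuous (BalancedPower.family A M n p) :=
  (withSeminorms_seminorm (BalancedPower.family A M n)).continuous_seminorm p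

/-- The completed tensor power `M ⊗̂_A ⋯ ⊗̂_A M` with `n` factors. -/
abbrev CompletedPower (n : ℕ) : Type _ := UniformSpace.Completion (BalancedPower A M n)

/-- The seminorm `p^{⊗̂n}` on the completed tensor power. -/
def CompletedPower.seminorm (p : {p : Seminorm ℂ M // Continuous p}) (n : ℕ) :
    Seminorm ℂ (CompletedPower A M n) :=
  completionSeminorm (BalancedPower.family A M n p) (BalancedPower.continuous_family A M n p)

/-! ## The analytic tensor algebra as a locally convex space -/

/-- The space of all sequences `(xₙ)` with `xₙ ∈ M^{⊗̂n}`, `n ≥ 1`, and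
`∑ₙ p^{⊗̂n}(xₙ) ρⁿ < ∞` for all continuous seminorms `p` on `M` and all `ρ > 0`.
The entry with index `n` is the component of degree `n + 1`. -/
def analyticTensorSubmodule : Submodule ℂ (∀ n : ℕ, CompletedPower A M (n + 1)) where
  carrier := {x | ∀ (p : {p : Seminorm ℂ M // Continuous p}) (ρ : ℝ), 0 < ρ →
    Summable fun n => CompletedPower.seminorm A M p (n + 1) (x n) * ρ ^ (n + 1)}
  add_mem' {x y} hx hy p ρ hρ := by
    refine Summable.of_nonneg_of_le (fun n => mul_nonneg (apply_nonneg _ _) (by positivity))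
      (fun n => ?_) ((hx p ρ hρ).add (hy p ρ hρ))
    rw [← add_mul]
    exact mul_le_mul_of_nonneg_right (map_add_le_add _ _ _) (by positivity)
  zero_mem' p ρ hρ := by simp
  smul_mem' r x hx p ρ hρ := by
    refine ((hx p ρ hρ).mul_left ‖r‖).congr fun n => ?_
    rw [Pi.smul_apply, map_smul_eq_mul, mul_assoc]

/-- The part `T̂_A(M)⁺` of positive degree of the analytic tensor algebra. -/
def AnalyticTensorPos : Type _ := analyticTensorSubmodule A M

instance : AddCommGroup (AnalyticTensorPos A M) :=
  inferInstanceAs (AddCommGroup (analyticTensorSubmodule A M))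

instance : Module ℂ (AnalyticTensorPos A M) :=
  inferInstanceAs (Module ℂ (analyticTensorSubmodule A M))

/-- The seminorm `‖(xₙ)‖_{p,ρ} = ∑ₙ p^{⊗̂n}(xₙ) ρⁿ`. -/
def AnalyticTensorPos.seminorm
    (i : {p : Seminorm ℂ M // Continuous p} × {ρ : ℝ // 0 < ρ}) :
    Seminorm ℂ (AnalyticTensorPos A M) :=
  Seminorm.of
    (fun x => ∑' n, CompletedPower.seminorm A M i.1 (n + 1) (x.1 n) * (i.2 : ℝ) ^ (n + 1))
    (fun x y => by
      have hρ : (0 : ℝ) < i.2 := i.2.2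
      rw [← (x.2 i.1 i.2 hρ).tsum_add (y.2 i.1 i.2 hρ)]
      refine ((x + y).2 i.1 i.2 hρ).tsum_le_tsum (fun n => ?_)
        ((x.2 i.1 i.2 hρ).add (y.2 i.1 i.2 hρ))
      rw [← add_mul]
      exact mul_le_mul_of_nonneg_right (map_add_le_add _ _ _) (by positivity))
    (fun r x => by
      rw [← tsum_mul_left]
      refine tsum_congr fun n => ?_
      rw [← mul_assoc, ← map_smul_eq_mul]
      rfl)

instance : UniformSpace (AnalyticTensorPos A M) :=
  seminormUniformSpace (AnalyticTensorPos.seminorm A M)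

/-- The analytic tensor algebra `T̂_A(M) = A ⊕ T̂_A(M)⁺`, as a topological vector space. -/
abbrev AnalyticTensor : Type _ := A × AnalyticTensorPos A M

variable {M} in
/-- The element of `T̂_A(M)` of degree `0` given by `a ∈ A`. -/
def AnalyticTensor.base (a : A) : AnalyticTensor A M := (a, 0)

variable {M} in
/-- The homogeneous element `x₀ ⊗ ⋯ ⊗ xₙ` of `T̂_A(M)`, of degree `n + 1`. -/
def AnalyticTensor.tensor (n : ℕ) (x : Fin (n + 1) → M) : AnalyticTensor A M :=
  (0, ⟨Pi.single n ((BalancedPower.tprod A x : BalancedPower A M (n + 1)) :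
      CompletedPower A M (n + 1)), fun p ρ _ => by
    refine summable_of_ne_finset_zero (s := {n}) fun k hk => ?_
    rw [Pi.single_eq_of_ne (by simpa using hk), map_zero, zero_mul]⟩)

variable {M} in
/-- The element of `T̂_A(M)` of degree `1` given by `x ∈ M`. -/
def AnalyticTensor.gen (x : M) : AnalyticTensor A M := AnalyticTensor.tensor A 0 fun _ => x

end Power

/-- A topological linear isomorphism `e` from the space `T̂_A(M)` onto a topological algebra `T`
transports the multiplication of `T` to the one of the analytic tensor algebra, i.e. to the
multiplication for which the inclusion of the algebraic tensor algebra
`T_A(M) = A ⊕ M ⊕ (M ⊗_A M) ⊕ ⋯` is a unital algebra homomorphism. As `T_A(M)` is generated by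
`A` and `M`, it suffices to describe the products of such elements. -/
structure IsAnalyticTensorAlgebra {A M T : Type*} [Ring A] [Algebra ℂ A] [TopologicalSpace A]
    [AddCommGroup M] [Module ℂ M] [Module A M] [Module Aᵐᵒᵖ M] [TopologicalSpace M]
    [Ring T] [Algebra ℂ T] [TopologicalSpace T] (e : AnalyticTensor A M ≃L[ℂ] T) : Prop where
  map_one : e (AnalyticTensor.base A 1) = 1
  map_mul : ∀ a b : A, e (AnalyticTensor.base A (a * b)) =
    e (AnalyticTensor.base A a) * e (AnalyticTensor.base A b)
  map_smul : ∀ (a : A) (x : M), e (AnalyticTensor.gen A (a • x)) =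
    e (AnalyticTensor.base A a) * e (AnalyticTensor.gen A x)
  map_op_smul : ∀ (a : A) (x : M), e (AnalyticTensor.gen A (MulOpposite.op a • x)) =
    e (AnalyticTensor.gen A x) * e (AnalyticTensor.base A a)
  map_tensor : ∀ (n : ℕ) (x : Fin (n + 1) → M), e (AnalyticTensor.tensor A n x) =
    (List.ofFn fun i => e (AnalyticTensor.gen A (x i))).prod

/-! ## Topologically inverse bimodules and compatible triples -/

/-- The structure of topologically inverse `A`-`⊗̂`-bimodules on `M` and `N = M⁻¹`: topological
isomorphisms of bimodules `i₁ : M ⊗̂_A N ≃ A` and `i₂ : N ⊗̂_A M ≃ A` making the two associativity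
diagrams commute. All maps involved are continuous and linear, and the elementary tensors span
dense subspaces, so that bilinearity over `A` and the diagrams are stated on elementary tensors. -/
structure TopologicallyInverse (A M N : Type*) [Ring A] [Algebra ℂ A] [TopologicalSpace A]
    [AddCommGroup M] [Module ℂ M] [Module A M] [Module Aᵐᵒᵖ M] [TopologicalSpace M]
    [AddCommGroup N] [Module ℂ N] [Module A N] [Module Aᵐᵒᵖ N] [TopologicalSpace N] where
  i₁ : CompletedTensor A M N ≃L[ℂ] A
  i₂ : CompletedTensor A N M ≃L[ℂ] A
  i₁_smul : ∀ (a : A) (x : M) (y : N),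
    i₁ (CompletedTensor.tmul A (a • x) y) = a * i₁ (CompletedTensor.tmul A x y)
  i₁_op_smul : ∀ (a : A) (x : M) (y : N),
    i₁ (CompletedTensor.tmul A x (MulOpposite.op a • y)) = i₁ (CompletedTensor.tmul A x y) * a
  i₂_smul : ∀ (a : A) (y : N) (x : M),
    i₂ (CompletedTensor.tmul A (a • y) x) = a * i₂ (CompletedTensor.tmul A y x)
  i₂_op_smul : ∀ (a : A) (y : N) (x : M),
    i₂ (CompletedTensor.tmul A y (MulOpposite.op a • x)) = i₂ (CompletedTensor.tmul A y x) * a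
  assoc₁ : ∀ (x : M) (y : N) (x' : M),
    i₁ (CompletedTensor.tmul A x y) • x' =
      MulOpposite.op (i₂ (CompletedTensor.tmul A y x')) • x
  assoc₂ : ∀ (y : N) (x : M) (y' : N),
    i₂ (CompletedTensor.tmul A y x) • y' =
      MulOpposite.op (i₁ (CompletedTensor.tmul A x y')) • y

/-- A topologically compatible triple `(θ, α, β)` with values in `B`: a continuous unital algebra
homomorphism `θ : A → B` and continuous homomorphisms of `A`-bimodules `α : M → B`, `β : N → B`
(where `A` acts on `B` through `θ`) with `α(x) β(y) = θ(i₁(x ⊗ y))` and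
`β(y) α(x) = θ(i₂(y ⊗ x))`. -/
structure CompatibleTriple {A M N : Type*} [Ring A] [Algebra ℂ A] [TopologicalSpace A]
    [AddCommGroup M] [Module ℂ M] [Module A M] [Module Aᵐᵒᵖ M] [TopologicalSpace M]
    [AddCommGroup N] [Module ℂ N] [Module A N] [Module Aᵐᵒᵖ N] [TopologicalSpace N]
    (h : TopologicallyInverse A M N)
    (B : Type*) [Ring B] [Algebra ℂ B] [TopologicalSpace B] where
  θ : A →A[ℂ] B
  α : M →L[ℂ] B
  β : N →L[ℂ] B
  α_smul : ∀ (a : A) (x : M), α (a • x) = θ a * α x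
  α_op_smul : ∀ (a : A) (x : M), α (MulOpposite.op a • x) = α x * θ a
  β_smul : ∀ (a : A) (y : N), β (a • y) = θ a * β y
  β_op_smul : ∀ (a : A) (y : N), β (MulOpposite.op a • y) = β y * θ a
  compat₁ : ∀ (x : M) (y : N), α x * β y = θ (h.i₁ (CompletedTensor.tmul A x y))
  compat₂ : ∀ (y : N) (x : M), β y * α x = θ (h.i₂ (CompletedTensor.tmul A y x))

/-- The relations `x ⊗ y - i₁(x ⊗ y)` and `y ⊗ x - i₂(y ⊗ x)` in `T̂_A(M ⊕ N)`. -/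
def laurentRelations {A M N : Type*} [Ring A] [Algebra ℂ A] [TopologicalSpace A]
    [AddCommGroup M] [Module ℂ M] [Module A M] [Module Aᵐᵒᵖ M] [TopologicalSpace M]
    [AddCommGroup N] [Module ℂ N] [Module A N] [Module Aᵐᵒᵖ N] [TopologicalSpace N]
    (h : TopologicallyInverse A M N) : Set (AnalyticTensor A (M × N)) :=
  {z | ∃ (x : M) (y : N),
    z = AnalyticTensor.tensor A 1 ![(x, 0), (0, y)] -
        AnalyticTensor.base A (h.i₁ (CompletedTensor.tmul A x y)) ∨
    z = AnalyticTensor.tensor A 1 ![(0, y), (x, 0)] -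
        AnalyticTensor.base A (h.i₂ (CompletedTensor.tmul A y x))}

end HatTensor

end

universe u v w z

noncomputable section

namespace HatTensor

theorem seminorm_sum_le {E ι : Type*} [AddCommGroup E] [Module ℂ E] (s : Seminorm ℂ E)
    (S : Finset ι) (g : ι → E) : s (∑ i ∈ S, g i) ≤ ∑ i ∈ S, s (g i) :=
  Finset.le_sum_of_subadditive s (map_zero s).le (map_add_le_add s) S g

section Infimum

variable {E X : Type*} [AddCommGroup E] [Module ℂ E] {t : X → E} {c : X → ℝ} {hc : ∀ x, 0 ≤ c x}
  {ht : Submodule.span ℂ (Set.range t) = ⊤}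

theorem infSeminorm_apply_le (x : X) : infSeminorm t c hc ht (t x) ≤ c x := by
  refine csInf_le ⟨0, ?_⟩ ⟨Finsupp.single x 1, by simp, by simp⟩
  rintro r ⟨f, -, rfl⟩
  exact Finset.sum_nonneg fun x _ => mul_nonneg (norm_nonneg _) (hc x)

theorem infSeminorm_lt_iff_exists {z : E} {r : ℝ} (h : infSeminorm t c hc ht z < r) :
    ∃ f : X →₀ ℂ, Finsupp.linearCombination ℂ t f = z ∧ (f.sum fun x a => ‖a‖ * c x) < r := by
  have ne : (costSet t c z).Nonempty := by
    have hz : z ∈ Submodule.span ℂ (Set.range t) := ht ▸ Submodule.mem_top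
    obtain ⟨f, hf⟩ := (Finsupp.mem_span_range_iff_exists_finsupp).1 hz
    exact ⟨_, f, hf, rfl⟩
  obtain ⟨-, ⟨f, hf, rfl⟩, hr⟩ := exists_lt_of_csInf_lt ne h
  exact ⟨f, hf, hr⟩

/-- A seminorm is bounded on a finite linear combination by the corresponding cost. -/
theorem seminorm_linearCombination_le (s : Seminorm ℂ E) {C : ℝ}
    (h : ∀ x, s (t x) ≤ C * c x) (f : X →₀ ℂ) :
    s (Finsupp.linearCombination ℂ t f) ≤ C * f.sum fun x a => ‖a‖ * c x := by
  rw [Finsupp.linearCombination_apply, Finsupp.mul_sum]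
  refine (seminorm_sum_le s f.support _).trans (Finset.sum_le_sum fun x _ => ?_)
  rw [map_smul_eq_mul]
  dsimp only
  rw [mul_left_comm]
  exact mul_le_mul_of_nonneg_left (h x) (norm_nonneg _)

theorem le_mul_infSeminorm (s : Seminorm ℂ E) {C : ℝ} (hC : 0 ≤ C)
    (h : ∀ x, s (t x) ≤ C * c x) (z : E) : s z ≤ C * infSeminorm t c hc ht z := by
  refine le_of_forall_pos_le_add fun ε hε => ?_
  have hC' : 0 < C + 1 := by linarith
  obtain ⟨f, rfl, hf⟩ := infSeminorm_lt_iff_exists (hc := hc) (ht := ht) (z := z)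
    (r := infSeminorm t c hc ht z + ε / (C + 1)) (by linarith [div_pos hε hC'])
  refine (seminorm_linearCombination_le s h f).trans
    ((mul_le_mul_of_nonneg_left hf.le hC).trans ?_)
  rw [mul_add]
  gcongr
  rw [mul_div_assoc', div_le_iff₀ hC']
  nlinarith

end Infimum

section Continuity

variable {E : Type*} [AddCommGroup E] [Module ℂ E]

theorem continuous_sup_seminorm [TopologicalSpace E] {p q : Seminorm ℂ E} (hp : Continuous p)
    (hq : Continuous q) : Continuous (p ⊔ q : Seminorm ℂ E) := by
  rw [Seminorm.coe_sup]
  exact hp.sup hq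

theorem continuous_finset_sup_seminorm [TopologicalSpace E] {ι : Type*} {p : ι → Seminorm ℂ E}
    {s : Finset ι} (hp : ∀ i ∈ s, Continuous (p i)) : Continuous ⇑(s.sup p) :=
  Finset.sup_induction (p := fun q : Seminorm ℂ E => Continuous q) continuous_const
    (fun _ h _ h' => continuous_sup_seminorm h h') hp

theorem continuous_smul_seminorm [TopologicalSpace E] {p : Seminorm ℂ E} (hp : Continuous p)
    (c : NNReal) : Continuous (c • p : Seminorm ℂ E) := by
  rw [FunLike.coe_smul]
  exact hp.const_smul c

theorem exists_continuous_seminorm_of_mem_nhds [TopologicalSpace E] [PolynormableSpace ℂ E]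
    {U : Set E} (hU : U ∈ 𝓝 (0 : E)) :
    ∃ p : Seminorm ℂ E, Continuous p ∧ ∀ x, p x < 1 → x ∈ U := by
  have hp := PolynormableSpace.withSeminorms ℂ E
  obtain ⟨s, r, hr, h⟩ := (hp.mem_nhds_iff 0 U).1 hU
  refine ⟨(Real.toNNReal r⁻¹) • s.sup _,
    continuous_smul_seminorm (hp.finset_sups.continuous_seminorm s) _, fun x hx => h ?_⟩
  rw [Seminorm.mem_ball_zero]
  rw [smul_apply, NNReal.smul_def, smul_eq_mul, Real.coe_toNNReal _ (by positivity),
    inv_mul_lt_iff₀ hr, mul_one] at hx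
  exact hx

/-- A linear map that is bounded with respect to continuous seminorms is continuous. -/
theorem continuous_of_forall_seminorm_le {F : Type*} [AddCommGroup F] [Module ℂ F]
    [TopologicalSpace E] [IsTopologicalAddGroup E] [ContinuousConstSMul ℂ E]
    [TopologicalSpace F] [IsTopologicalAddGroup F]
    [PolynormableSpace ℂ F] (f : E →ₗ[ℂ] F)
    (h : ∀ r : Seminorm ℂ F, Continuous r → ∃ (C : ℝ) (p : Seminorm ℂ E), Continuous p ∧
      ∀ x, r (f x) ≤ C * p x) : Continuous f := by
  refine continuous_of_continuousAt_zero f ?_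
  rw [ContinuousAt, map_zero]
  intro U hU
  obtain ⟨r, hr, hrU⟩ := exists_continuous_seminorm_of_mem_nhds hU
  obtain ⟨C, p, hp, hC⟩ := h r hr
  have : Filter.Tendsto (fun x => C * p x) (𝓝 0) (𝓝 0) := by
    simpa using (continuous_const.mul hp).tendsto (0 : E) (f := fun x => C * p x)
  refine Filter.mem_map.2 ?_
  filter_upwards [this.eventually_lt_const one_pos] with x hx
  exact hrU _ ((hC x).trans_lt hx)

theorem continuous_seminorm_of_le [TopologicalSpace E] [IsTopologicalAddGroup E]
    {p q : Seminorm ℂ E} (hq : Continuous q) (h : ∀ x, p x ≤ q x) : Continuous p :=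
  Seminorm.continuous_of_le hq h

end Continuity

section Completion

variable {E : Type*} [AddCommGroup E] [Module ℂ E] [UniformSpace E] [IsUniformAddGroup E]
  [UniformContinuousConstSMul ℂ E]

theorem continuous_completionSeminorm (p : Seminorm ℂ E) (hp : Continuous p) :
    Continuous (completionSeminorm p hp) :=
  UniformSpace.Completion.continuous_extension (f := p)

@[simp]
theorem completionSeminorm_coe (p : Seminorm ℂ E) (hp : Continuous p) (x : E) :
    completionSeminorm p hp (x : UniformSpace.Completion E) = p x :=
  UniformSpace.Completion.extension_coe
    (Seminorm.uniformContinuous_of_continuousAt_zero hp.continuousAt) x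

theorem withSeminorms_completion {ι : Type*} {p : ι → Seminorm ℂ E} (hp : WithSeminorms p) :
    WithSeminorms fun i => completionSeminorm (p i) (hp.continuous_seminorm i) := by
  refine (SeminormFamily.withSeminorms_iff_nhds_eq_iInf _).2 (le_antisymm ?_ ?_)
  · refine le_iInf fun i => Filter.map_le_iff_le_comap.1 ?_
    have := (continuous_completionSeminorm (p i) (hp.continuous_seminorm i)).tendsto 0
    rwa [map_zero] at this
  · intro U hU
    obtain ⟨V, ⟨hV, hVc⟩, hVU⟩ := (closed_nhds_basis (0 : UniformSpace.Completion E)).mem_iff.1 hU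
    have hV' : ((↑) : E → UniformSpace.Completion E) ⁻¹' V ∈ 𝓝 (0 : E) :=
      (UniformSpace.Completion.continuous_coe E).continuousAt.preimage_mem_nhds
        (by rwa [UniformSpace.Completion.coe_zero])
    obtain ⟨s, r, hr, h⟩ := (hp.mem_nhds_iff 0 _).1 hV'
    have hW : (⋂ i ∈ s, {x | completionSeminorm (p i) (hp.continuous_seminorm i) x < r}) ∈
        ⨅ i, (𝓝 (0 : ℝ)).comap (completionSeminorm (p i) (hp.continuous_seminorm i)) := by
      refine (Filter.biInter_finset_mem s).2 fun i _ => Filter.mem_iInf_of_mem i ?_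
      exact Filter.preimage_mem_comap (gt_mem_nhds hr)
    refine Filter.mem_of_superset hW (Set.Subset.trans ?_ hVU)
    have hopen : IsOpen
        (⋂ i ∈ s, {x | completionSeminorm (p i) (hp.continuous_seminorm i) x < r}) :=
      isOpen_biInter_finset fun i _ =>
        isOpen_lt (continuous_completionSeminorm _ _) continuous_const
    refine (UniformSpace.Completion.denseRange_coe.open_subset_closure_inter hopen).trans
      (closure_minimal ?_ hVc)
    rintro _ ⟨hx, x, rfl⟩
    refine h ?_
    rw [Seminorm.mem_ball_zero]
    refine Seminorm.finset_sup_apply_lt hr fun i hi => ?_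
    simpa using Set.mem_iInter₂.1 hx i hi

theorem completionSeminorm_comp_le {F : Type*} [AddCommGroup F] [Module ℂ F] [TopologicalSpace F]
    (p : Seminorm ℂ E) (hp : Continuous p) (r : Seminorm ℂ F) (hr : Continuous r)
    (f : UniformSpace.Completion E →L[ℂ] F) {C : ℝ}
    (h : ∀ x : E, r (f x) ≤ C * p x) (z : UniformSpace.Completion E) :
    r (f z) ≤ C * completionSeminorm p hp z := by
  refine UniformSpace.Completion.induction_on z (isClosed_le (hr.comp f.continuous)
    (continuous_const.mul (continuous_completionSeminorm p hp))) fun x => ?_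
  rw [completionSeminorm_coe]
  exact h x

/-- The extension of a continuous linear map to the completion. -/
def completionLift {F : Type*} [AddCommGroup F] [Module ℂ F] [UniformSpace F]
    [IsUniformAddGroup F] [ContinuousConstSMul ℂ F] [CompleteSpace F] [T2Space F]
    (f : E →ₗ[ℂ] F) (hf : Continuous f) : UniformSpace.Completion E →L[ℂ] F where
  toFun := f.toAddMonoidHom.extension hf
  map_add' := map_add _
  map_smul' c z := by
    refine UniformSpace.Completion.induction_on z (isClosed_eq
      ((AddMonoidHom.continuous_extension _ hf).comp (continuous_const_smul c))
      ((AddMonoidHom.continuous_extension _ hf).const_smul c)) fun x => ?_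
    rw [← UniformSpace.Completion.coe_smul]
    exact ((AddMonoidHom.extension_coe f.toAddMonoidHom hf _).trans (map_smul f c x)).trans
      (congrArg (c • ·) (AddMonoidHom.extension_coe f.toAddMonoidHom hf x).symm)
  cont := AddMonoidHom.continuous_extension _ hf

@[simp]
theorem completionLift_coe {F : Type*} [AddCommGroup F] [Module ℂ F] [UniformSpace F]
    [IsUniformAddGroup F] [ContinuousConstSMul ℂ F] [CompleteSpace F] [T2Space F]
    (f : E →ₗ[ℂ] F) (hf : Continuous f) (x : E) : completionLift f hf x = f x :=
  AddMonoidHom.extension_coe _ hf x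

end Completion

section Summation

variable {F : Type*} [AddCommGroup F] [Module ℂ F] [UniformSpace F] [IsUniformAddGroup F]
  [PolynormableSpace ℂ F] {ι : Type*}

theorem summable_of_summable_seminorm [CompleteSpace F] {f : ι → F}
    (h : ∀ r : Seminorm ℂ F, Continuous r → Summable fun i => r (f i)) : Summable f := by
  refine summable_iff_vanishing.2 fun U hU => ?_
  obtain ⟨r, hr, hrU⟩ := exists_continuous_seminorm_of_mem_nhds hU
  obtain ⟨s, hs⟩ := summable_iff_vanishing.1 (h r hr) _ (gt_mem_nhds one_pos)
  exact ⟨s, fun t ht => hrU _ ((seminorm_sum_le r t f).trans_lt (hs t ht))⟩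

omit [IsUniformAddGroup F] [PolynormableSpace ℂ F] in
theorem seminorm_tsum_le {f : ι → F} (hf : Summable f) {r : Seminorm ℂ F} (hr : Continuous r)
    {g : ι → ℝ} (hg : Summable g) (h : ∀ i, r (f i) ≤ g i) : r (∑' i, f i) ≤ ∑' i, g i := by
  refine le_of_tendsto_of_tendsto ((hr.tendsto _).comp hf.hasSum) hg.hasSum
    (Filter.Eventually.of_forall fun s => ?_)
  exact (seminorm_sum_le r s f).trans
    (Finset.sum_le_sum fun i _ => h i)

end Summation

section Power

variable (A : Type*) {M : Type*} [Ring A]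
  [AddCommGroup M] [Module ℂ M] [Module A M] [Module Aᵐᵒᵖ M] [TopologicalSpace M]

/-- A multilinear map is balanced over `A` if it identifies the right action on each argument with
the left action on the next one. -/
def IsBalanced {F : Type*} [AddCommGroup F] [Module ℂ F] {n : ℕ}
    (f : MultilinearMap ℂ (fun _ : Fin n => M) F) : Prop :=
  ∀ (x : Fin n → M) (a : A) (i j : Fin n), (j : ℕ) = i + 1 →
    f (Function.update x i (MulOpposite.op a • x i)) = f (Function.update x j (a • x j))

/-- The elementary tensors as a multilinear map. -/
def BalancedPower.tprodMap (n : ℕ) :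
    MultilinearMap ℂ (fun _ : Fin n => M) (BalancedPower A M n) :=
  (powerRel A M n).mkQ.compMultilinearMap (PiTensorProduct.tprod ℂ)

omit [TopologicalSpace M] in
theorem BalancedPower.isBalanced_tprodMap (n : ℕ) :
    IsBalanced A (BalancedPower.tprodMap A (M := M) n) := fun x a i j hij =>
  (Submodule.Quotient.eq (powerRel A M n)).2 (Submodule.subset_span ⟨x, a, i, j, hij, rfl⟩)

variable {A}

/-- The linear map on the tensor power induced by a balanced multilinear map. -/
def BalancedPower.lift {F : Type*} [AddCommGroup F] [Module ℂ F] {n : ℕ}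
    (f : MultilinearMap ℂ (fun _ : Fin n => M) F) (hf : IsBalanced A f) :
    BalancedPower A M n →ₗ[ℂ] F :=
  (powerRel A M n).liftQ (PiTensorProduct.lift f) (by
    refine Submodule.span_le.2 ?_
    rintro _ ⟨x, a, i, j, hij, rfl⟩
    simp [hf x a i j hij])

omit [TopologicalSpace M] in
@[simp]
theorem BalancedPower.lift_tprod {F : Type*} [AddCommGroup F] [Module ℂ F] {n : ℕ}
    (f : MultilinearMap ℂ (fun _ : Fin n => M) F) (hf : IsBalanced A f) (x : Fin n → M) :
    BalancedPower.lift f hf (BalancedPower.tprod A x) = f x :=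
  ((powerRel A M n).liftQ_apply _ _).trans (PiTensorProduct.lift.tprod x)

variable (A M)

/-- The canonical map from the tensor power to its completion, as a linear map. -/
def BalancedPower.toCompleted (n : ℕ) : BalancedPower A M n →ₗ[ℂ] CompletedPower A M n where
  toFun w := w
  map_add' := UniformSpace.Completion.coe_add
  map_smul' := UniformSpace.Completion.coe_smul

theorem CompletedPower.withSeminorms (n : ℕ) :
    WithSeminorms fun p => CompletedPower.seminorm A M p n :=
  withSeminorms_completion (withSeminorms_seminorm (BalancedPower.family A M n))

instance (n : ℕ) : PolynormableSpace ℂ (CompletedPower A M n) :=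
  (CompletedPower.withSeminorms A M n).toPolynormableSpace

instance (n : ℕ) : PolynormableSpace ℂ (BalancedPower A M n) :=
  (withSeminorms_seminorm (BalancedPower.family A M n)).toPolynormableSpace

theorem CompletedPower.continuous_seminorm (p : {p : Seminorm ℂ M // Continuous p}) (n : ℕ) :
    Continuous (CompletedPower.seminorm A M p n) :=
  continuous_completionSeminorm _ _

variable {M}

variable {A} in
theorem BalancedPower.seminorm_tprod_le (p : Seminorm ℂ M) {n : ℕ} (x : Fin n → M) :
    BalancedPower.seminorm A p n (BalancedPower.tprod A x) ≤ ∏ i, p (x i) :=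
  infSeminorm_apply_le (t := fun x : Fin n → M => BalancedPower.tprod A x)
    (c := fun x => ∏ i, p (x i)) (hc := fun x => Finset.prod_nonneg fun i _ => apply_nonneg p (x i))
    (ht := BalancedPower.span_tprod A M n) x

variable {A} in
/-- A seminorm on the tensor power is bounded by a projective one as soon as it is on elementary
tensors. -/
theorem BalancedPower.le_mul_seminorm {p : Seminorm ℂ M} {n : ℕ}
    (s : Seminorm ℂ (BalancedPower A M n)) {C : ℝ} (hC : 0 ≤ C)
    (h : ∀ x, s (BalancedPower.tprod A x) ≤ C * ∏ i, p (x i)) (z : BalancedPower A M n) :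
    s z ≤ C * BalancedPower.seminorm A p n z :=
  le_mul_infSeminorm (t := fun x : Fin n → M => BalancedPower.tprod A x)
    (c := fun x => ∏ i, p (x i)) (hc := fun x => Finset.prod_nonneg fun i _ => apply_nonneg p (x i))
    (ht := BalancedPower.span_tprod A M n) s hC h z

@[simp]
theorem CompletedPower.seminorm_coe (p : {p : Seminorm ℂ M // Continuous p}) {n : ℕ}
    (z : BalancedPower A M n) : CompletedPower.seminorm A M p n z = BalancedPower.seminorm A p.1 n z :=
  completionSeminorm_coe _ _ _

theorem CompletedPower.seminorm_tprod_le (p : {p : Seminorm ℂ M // Continuous p}) {n : ℕ}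
    (x : Fin n → M) :
    CompletedPower.seminorm A M p n (BalancedPower.tprod A x : BalancedPower A M n) ≤
      ∏ i, p.1 (x i) :=
  (CompletedPower.seminorm_coe A p _).le.trans (BalancedPower.seminorm_tprod_le _ x)

theorem CompletedPower.seminorm_mul_pow_le {p p' : {p : Seminorm ℂ M // Continuous p}} {ρ : ℝ}
    (hρ : 0 ≤ ρ) (h : ∀ x, p.1 x * ρ ≤ p'.1 x) (n : ℕ) (z : CompletedPower A M n) :
    CompletedPower.seminorm A M p n z * ρ ^ n ≤ CompletedPower.seminorm A M p' n z := by
  refine UniformSpace.Completion.induction_on z (isClosed_le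
    ((continuous_seminorm A M p n).mul continuous_const) (continuous_seminorm A M p' n))
    fun w => ?_
  have key := BalancedPower.le_mul_seminorm (p := p'.1)
    (Real.toNNReal (ρ ^ n) • BalancedPower.seminorm A p.1 n) zero_le_one (fun x => by
      rw [one_mul, smul_apply, NNReal.smul_def, smul_eq_mul, mul_comm,
        Real.coe_toNNReal _ (pow_nonneg hρ n)]
      refine (mul_le_mul_of_nonneg_right (BalancedPower.seminorm_tprod_le p.1 x)
        (by positivity)).trans ?_
      calc (∏ i, p.1 (x i)) * ρ ^ n = ∏ i, p.1 (x i) * ρ := by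
            rw [Finset.prod_mul_distrib]; simp
        _ ≤ ∏ i, p'.1 (x i) := Finset.prod_le_prod
            (fun i _ => mul_nonneg (apply_nonneg _ _) hρ) fun i _ => h _) w
  rw [one_mul, smul_apply, NNReal.smul_def, smul_eq_mul, mul_comm,
    Real.coe_toNNReal _ (pow_nonneg hρ n)] at key
  simpa only [CompletedPower.seminorm_coe] using key

variable (M)

namespace AnalyticTensorPos

theorem withSeminorms : WithSeminorms (AnalyticTensorPos.seminorm A M) :=
  withSeminorms_seminorm _

instance : IsUniformAddGroup (AnalyticTensorPos A M) := isUniformAddGroup_seminorm _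

instance : ContinuousSMul ℂ (AnalyticTensorPos A M) := (withSeminorms A M).continuousSMul

instance : PolynormableSpace ℂ (AnalyticTensorPos A M) := (withSeminorms A M).toPolynormableSpace

variable {A M}

theorem summable (x : AnalyticTensorPos A M)
    (i : {p : Seminorm ℂ M // Continuous p} × {ρ : ℝ // 0 < ρ}) :
    Summable fun n => CompletedPower.seminorm A M i.1 (n + 1) (x.1 n) * (i.2 : ℝ) ^ (n + 1) :=
  x.2 i.1 i.2 i.2.2

theorem term_nonneg (i : {p : Seminorm ℂ M // Continuous p} × {ρ : ℝ // 0 < ρ}) (n : ℕ)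
    (z : CompletedPower A M (n + 1)) :
    0 ≤ CompletedPower.seminorm A M i.1 (n + 1) z * (i.2 : ℝ) ^ (n + 1) :=
  mul_nonneg (apply_nonneg _ _) (pow_nonneg i.2.2.le _)

theorem seminorm_apply (i : {p : Seminorm ℂ M // Continuous p} × {ρ : ℝ // 0 < ρ})
    (x : AnalyticTensorPos A M) : AnalyticTensorPos.seminorm A M i x =
      ∑' n, CompletedPower.seminorm A M i.1 (n + 1) (x.1 n) * (i.2 : ℝ) ^ (n + 1) := rfl

theorem term_le_seminorm (i : {p : Seminorm ℂ M // Continuous p} × {ρ : ℝ // 0 < ρ})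
    (x : AnalyticTensorPos A M) (n : ℕ) :
    CompletedPower.seminorm A M i.1 (n + 1) (x.1 n) * (i.2 : ℝ) ^ (n + 1) ≤
      AnalyticTensorPos.seminorm A M i x :=
  (x.summable i).le_tsum n fun k _ => term_nonneg i k _

theorem sum_le_seminorm (i : {p : Seminorm ℂ M // Continuous p} × {ρ : ℝ // 0 < ρ})
    (x : AnalyticTensorPos A M) (s : Finset ℕ) :
    ∑ n ∈ s, CompletedPower.seminorm A M i.1 (n + 1) (x.1 n) * (i.2 : ℝ) ^ (n + 1) ≤
      AnalyticTensorPos.seminorm A M i x :=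
  (x.summable i).sum_le_tsum s fun k _ => term_nonneg i k _

variable (A M) in
/-- The component of degree `n + 1`. -/
def proj (n : ℕ) : AnalyticTensorPos A M →L[ℂ] CompletedPower A M (n + 1) where
  toFun x := x.1 n
  map_add' _ _ := rfl
  map_smul' _ _ := rfl
  cont := (CompletedPower.withSeminorms A M (n + 1)).continuous_of_continuous_comp
    ((LinearMap.proj n : (∀ n : ℕ, CompletedPower A M (n + 1)) →ₗ[ℂ] _).comp
      (analyticTensorSubmodule A M).subtype : AnalyticTensorPos A M →ₗ[ℂ] _) fun p =>
    Seminorm.continuous_of_le ((withSeminorms A M).continuous_seminorm (p, ⟨1, one_pos⟩))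
      fun x => (by simpa using term_le_seminorm (p, ⟨1, one_pos⟩) x n :
        CompletedPower.seminorm A M p (n + 1) (x.1 n) ≤ _)

instance : T2Space (AnalyticTensorPos A M) := by
  have : T1Space (AnalyticTensorPos A M) := by
    refine (withSeminorms A M).T1_of_separating fun x hx => ?_
    by_contra! h
    refine hx (Subtype.ext (funext fun n => ?_))
    by_contra hn
    obtain ⟨p, hp⟩ := (CompletedPower.withSeminorms A M (n + 1)).separating_of_T1 (x.1 n) hn
    refine hp (le_antisymm ?_ (apply_nonneg _ _))
    simpa [h] using term_le_seminorm (p, ⟨1, one_pos⟩) x n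
  infer_instance

instance : CompleteSpace (AnalyticTensorPos A M) := by
  refine ⟨fun {f} hf => ?_⟩
  have hne := hf.1
  have hlim (n : ℕ) : ∃ z, Filter.Tendsto (proj A M n) f (𝓝 z) :=
    CompleteSpace.complete (hf.map (uniformContinuous_addMonoidHom_of_continuous
      (f := (proj A M n : AnalyticTensorPos A M →+ CompletedPower A M (n + 1)))
      (proj A M n).continuous))
  choose x hx using hlim
  have key (i : {p : Seminorm ℂ M // Continuous p} × {ρ : ℝ // 0 < ρ}) {ε : ℝ} (hε : 0 < ε) :
      ∃ s ∈ f, ∀ y ∈ s, ∀ t : Finset ℕ, ∑ n ∈ t,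
        CompletedPower.seminorm A M i.1 (n + 1) (y.1 n - x n) * (i.2 : ℝ) ^ (n + 1) ≤ ε := by
    have hV : {w : AnalyticTensorPos A M × AnalyticTensorPos A M |
        AnalyticTensorPos.seminorm A M i (w.1 - w.2) < ε} ∈ uniformity (AnalyticTensorPos A M) := by
      rw [uniformity_eq_comap_nhds_zero_swapped]
      exact Filter.preimage_mem_comap
        (((withSeminorms A M).continuous_seminorm i).continuousAt.preimage_mem_nhds
          (t := Set.Iio ε) (by simpa using Iio_mem_nhds hε))
    obtain ⟨s, hs, hsV⟩ := (cauchy_iff.1 hf).2 _ hV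
    refine ⟨s, hs, fun y hy t => ?_⟩
    have htend : Filter.Tendsto (fun z : AnalyticTensorPos A M => ∑ n ∈ t,
        CompletedPower.seminorm A M i.1 (n + 1) (y.1 n - z.1 n) * (i.2 : ℝ) ^ (n + 1)) f
        (𝓝 (∑ n ∈ t,
        CompletedPower.seminorm A M i.1 (n + 1) (y.1 n - x n) * (i.2 : ℝ) ^ (n + 1))) :=
      tendsto_finsetSum _ fun n _ => (((CompletedPower.continuous_seminorm A M i.1 _).tendsto
        _).comp ((hx n).const_sub _)).mul_const _
    refine le_of_tendsto htend (Filter.mem_of_superset hs fun z hz => ?_)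
    exact (sum_le_seminorm i (y - z) t).trans (hsV (Set.mk_mem_prod hy hz)).le
  have hmem : x ∈ analyticTensorSubmodule A M := by
    intro p ρ hρ
    obtain ⟨s, hs, h⟩ := key (p, ⟨ρ, hρ⟩) one_pos
    obtain ⟨y, hy⟩ := Filter.nonempty_of_mem hs
    have h1 := summable_of_sum_le (fun n => term_nonneg (p, ⟨ρ, hρ⟩) n _) (h y hy)
    refine Summable.of_nonneg_of_le (fun n => term_nonneg (p, ⟨ρ, hρ⟩) n _) (fun n => ?_)
      ((y.summable (p, ⟨ρ, hρ⟩)).add h1)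
    rw [← add_mul]
    refine mul_le_mul_of_nonneg_right ?_ (pow_nonneg hρ.le _)
    calc _ = CompletedPower.seminorm A M p (n + 1) (y.1 n - (y.1 n - x n)) := by rw [sub_sub_cancel]
      _ ≤ _ := map_sub_le_add _ _ _
  refine ⟨⟨x, hmem⟩, ((withSeminorms A M).tendsto_nhds id _).2 fun i ε hε => ?_⟩
  obtain ⟨s, hs, h⟩ := key i (half_pos hε)
  refine Filter.mem_of_superset hs fun y hy => ?_
  refine lt_of_le_of_lt ?_ (half_lt_self hε)
  exact ((y - ⟨x, hmem⟩ : AnalyticTensorPos A M).summable i).tsum_le_of_sum_le (h y hy)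

variable (A M) in
/-- The inclusion of the component of degree `n + 1`. -/
def singleLinear (n : ℕ) : CompletedPower A M (n + 1) →ₗ[ℂ] AnalyticTensorPos A M where
  toFun z := ⟨Pi.single n z, fun p ρ _ => by
    refine summable_of_ne_finset_zero (s := {n}) fun k hk => ?_
    rw [Pi.single_eq_of_ne (by simpa using hk), map_zero, zero_mul]⟩
  map_add' z w := Subtype.ext (Pi.single_add (f := fun n => CompletedPower A M (n + 1)) n z w)
  map_smul' c z := Subtype.ext (Pi.single_smul (f := fun n => CompletedPower A M (n + 1)) n c z)

theorem seminorm_singleLinear (i : {p : Seminorm ℂ M // Continuous p} × {ρ : ℝ // 0 < ρ}) (n : ℕ)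
    (z : CompletedPower A M (n + 1)) : AnalyticTensorPos.seminorm A M i (singleLinear A M n z) =
      CompletedPower.seminorm A M i.1 (n + 1) z * (i.2 : ℝ) ^ (n + 1) := by
  have hval (k : ℕ) : (singleLinear A M n z).1 k =
      (Pi.single n z : ∀ n, CompletedPower A M (n + 1)) k := rfl
  rw [seminorm_apply, tsum_eq_single n fun k hk => ?_]
  · rw [hval, Pi.single_eq_same]
  · rw [hval, Pi.single_eq_of_ne hk, map_zero, zero_mul]

variable (A M) in
/-- The inclusion of the component of degree `n + 1`, as a continuous linear map. -/
def single (n : ℕ) : CompletedPower A M (n + 1) →L[ℂ] AnalyticTensorPos A M where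
  toLinearMap := singleLinear A M n
  cont := (withSeminorms A M).continuous_of_continuous_comp (singleLinear A M n) fun i =>
    ((CompletedPower.continuous_seminorm A M i.1 (n + 1)).mul_const ((i.2 : ℝ) ^ (n + 1))).congr
      fun z => (seminorm_singleLinear i n z).symm

theorem seminorm_single (i : {p : Seminorm ℂ M // Continuous p} × {ρ : ℝ // 0 < ρ}) (n : ℕ)
    (z : CompletedPower A M (n + 1)) : AnalyticTensorPos.seminorm A M i (single A M n z) =
      CompletedPower.seminorm A M i.1 (n + 1) z * (i.2 : ℝ) ^ (n + 1) :=
  seminorm_singleLinear i n z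

theorem hasSum_single (x : AnalyticTensorPos A M) :
    HasSum (fun n => single A M n (x.1 n)) x := by
  classical
  refine ((withSeminorms A M).tendsto_nhds _ _).2 fun i ε hε => ?_
  have hsum := (x.summable i).hasSum
  filter_upwards [hsum.eventually (lt_mem_nhds (sub_lt_self _ hε))] with s hs
  have hval (n : ℕ) : (∑ k ∈ s, single A M k (x.1 k) - x).1 n = if n ∈ s then 0 else - x.1 n := by
    change proj A M n (∑ k ∈ s, single A M k (x.1 k) - x) = _
    rw [map_sub, map_sum]
    change ∑ k ∈ s, (Pi.single k (x.1 k) : ∀ n, CompletedPower A M (n + 1)) n - x.1 n = _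
    rw [Finset.sum_pi_single]
    split_ifs <;> simp
  rw [seminorm_apply]
  have h1 : HasSum (fun n => if n ∈ s then
      CompletedPower.seminorm A M i.1 (n + 1) (x.1 n) * (i.2 : ℝ) ^ (n + 1) else 0)
      (∑ n ∈ s, CompletedPower.seminorm A M i.1 (n + 1) (x.1 n) * (i.2 : ℝ) ^ (n + 1)) := by
    rw [← Finset.sum_congr rfl fun n hn => if_pos hn]
    exact hasSum_sum_of_ne_finset_zero fun n hn => if_neg hn
  have h2 := (hsum.sub h1).tsum_eq
  have h3 : ∀ n, CompletedPower.seminorm A M i.1 (n + 1)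
      ((∑ k ∈ s, single A M k (x.1 k) - x).1 n) * (i.2 : ℝ) ^ (n + 1) =
      CompletedPower.seminorm A M i.1 (n + 1) (x.1 n) * (i.2 : ℝ) ^ (n + 1) - if n ∈ s then
      CompletedPower.seminorm A M i.1 (n + 1) (x.1 n) * (i.2 : ℝ) ^ (n + 1) else 0 := fun n => by
    rw [hval]
    split_ifs <;> simp
  rw [tsum_congr h3, h2]
  linarith

end AnalyticTensorPos

end Power

namespace AnalyticTensor

variable {A M : Type*} [Ring A] [Algebra ℂ A]
  [AddCommGroup M] [Module ℂ M] [Module A M] [Module Aᵐᵒᵖ M] [TopologicalSpace M]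

omit [Algebra ℂ A] in
theorem tensor_eq_single (n : ℕ) (x : Fin (n + 1) → M) :
    tensor A n x = (0, AnalyticTensorPos.single A M n (BalancedPower.tprod A x :
      BalancedPower A M (n + 1))) := rfl

/-- The seminorm `(a, x) ↦ q a + ‖x‖_{p,1}`. -/
def seminorm (q : Seminorm ℂ A) (p : {p : Seminorm ℂ M // Continuous p}) :
    Seminorm ℂ (AnalyticTensor A M) :=
  q.comp (LinearMap.fst ℂ A (AnalyticTensorPos A M)) +
    (AnalyticTensorPos.seminorm A M (p, ⟨1, one_pos⟩)).comp
      (LinearMap.snd ℂ A (AnalyticTensorPos A M))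

theorem seminorm_apply (q : Seminorm ℂ A) (p : {p : Seminorm ℂ M // Continuous p})
    (z : AnalyticTensor A M) : seminorm q p z =
      q z.1 + AnalyticTensorPos.seminorm A M (p, ⟨1, one_pos⟩) z.2 := rfl

theorem seminorm_base (q : Seminorm ℂ A) (p : {p : Seminorm ℂ M // Continuous p}) (a : A) :
    seminorm q p (base A a) = q a := by
  rw [seminorm_apply]
  simp [base]

theorem seminorm_tensor_le (q : Seminorm ℂ A) (p : {p : Seminorm ℂ M // Continuous p}) (n : ℕ)
    (x : Fin (n + 1) → M) : seminorm q p (tensor A n x) ≤ ∏ i, p.1 (x i) := by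
  rw [tensor_eq_single, seminorm_apply, AnalyticTensorPos.seminorm_single, map_zero, zero_add,
    one_pow, mul_one]
  exact CompletedPower.seminorm_tprod_le A p x

variable [TopologicalSpace A]

theorem continuous_seminorm {q : Seminorm ℂ A} (hq : Continuous q)
    (p : {p : Seminorm ℂ M // Continuous p}) : Continuous (seminorm (A := A) q p) :=
  (hq.comp continuous_fst).add
    (((AnalyticTensorPos.withSeminorms A M).continuous_seminorm (p, ⟨1, one_pos⟩)).comp
      continuous_snd)

variable {Y : Type*} [AddCommGroup Y] [Module ℂ Y]

/-- Continuous linear maps on the analytic tensor algebra are determined by their values on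
elements of degree zero and elementary tensors. -/
theorem continuousLinearMap_ext [TopologicalSpace Y] [T2Space Y] {F G : AnalyticTensor A M →L[ℂ] Y}
    (h₀ : ∀ a, F (base A a) = G (base A a)) (h : ∀ n x, F (tensor A n x) = G (tensor A n x)) :
    F = G := by
  have h1 (n : ℕ) (z : CompletedPower A M (n + 1)) :
      F (0, AnalyticTensorPos.single A M n z) = G (0, AnalyticTensorPos.single A M n z) := by
    have hc (H : AnalyticTensor A M →L[ℂ] Y) : Continuous fun z : CompletedPower A M (n + 1) =>
        H (0, AnalyticTensorPos.single A M n z) :=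
      H.continuous.comp (continuous_const.prodMk (AnalyticTensorPos.single A M n).continuous)
    refine UniformSpace.Completion.induction_on z (isClosed_eq (hc F) (hc G)) fun w => ?_
    let S : (AnalyticTensor A M →L[ℂ] Y) → BalancedPower A M (n + 1) →ₗ[ℂ] Y := fun H =>
      H.toLinearMap ∘ₗ LinearMap.inr ℂ A (AnalyticTensorPos A M) ∘ₗ
        (AnalyticTensorPos.single A M n).toLinearMap ∘ₗ BalancedPower.toCompleted A M (n + 1)
    have hS : S F = S G := LinearMap.ext_on_range (BalancedPower.span_tprod A M (n + 1)) (h n)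
    exact LinearMap.congr_fun hS w
  refine ContinuousLinearMap.ext fun ⟨a, t⟩ => ?_
  have h2 (H : AnalyticTensor A M →L[ℂ] Y) :
      HasSum (fun n => H (0, AnalyticTensorPos.single A M n (t.1 n))) (H (0, t)) :=
    (AnalyticTensorPos.hasSum_single t).map
      (H.toLinearMap ∘ₗ LinearMap.inr ℂ A (AnalyticTensorPos A M))
      (H.continuous.comp (continuous_const.prodMk continuous_id))
  have h3 : F (0, t) = G (0, t) :=
    (h2 F).unique (by simpa only [h1] using h2 G)
  have h4 : ((a, t) : AnalyticTensor A M) = base A a + (0, t) := by simp [base]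
  rw [h4, map_add, map_add, h₀, h3]

variable [IsTopologicalAddGroup A] [ContinuousSMul ℂ A]
  [UniformSpace Y] [IsUniformAddGroup Y] [PolynormableSpace ℂ Y] [CompleteSpace Y] [T2Space Y]

/-- Continuous linear maps on the analytic tensor algebra can be prescribed on elements of degree
zero and on elementary tensors by suitably bounded maps. -/
theorem exists_continuousLinearMap (f₀ : A →ₗ[ℂ] Y)
    (f : ∀ n, MultilinearMap ℂ (fun _ : Fin (n + 1) => M) Y) (hf : ∀ n, IsBalanced A (f n))
    (hb : ∀ r : Seminorm ℂ Y, Continuous r → ∃ C : ℝ, 0 ≤ C ∧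
      ∃ (q : Seminorm ℂ A) (p : {p : Seminorm ℂ M // Continuous p}), Continuous q ∧
        (∀ a, r (f₀ a) ≤ C * q a) ∧ ∀ n x, r (f n x) ≤ C * ∏ i, p.1 (x i)) :
    ∃ F : AnalyticTensor A M →L[ℂ] Y, (∀ a, F (base A a) = f₀ a) ∧
      (∀ n x, F (tensor A n x) = f n x) ∧
      ∀ r : Seminorm ℂ Y, Continuous r → ∀ C : ℝ, 0 ≤ C →
        ∀ (q : Seminorm ℂ A) (p : {p : Seminorm ℂ M // Continuous p}),
        (∀ a, r (f₀ a) ≤ C * q a) → (∀ n x, r (f n x) ≤ C * ∏ i, p.1 (x i)) →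
        ∀ z, r (F z) ≤ C * seminorm q p z := by
  have : ContinuousSMul ℂ Y := (PolynormableSpace.withSeminorms ℂ Y).continuousSMul
  let g (n : ℕ) := BalancedPower.lift (f n) (hf n)
  have hg (n : ℕ) {r : Seminorm ℂ Y} {C : ℝ} (hC : 0 ≤ C)
      {p : {p : Seminorm ℂ M // Continuous p}} (h : ∀ n x, r (f n x) ≤ C * ∏ i, p.1 (x i))
      (w : BalancedPower A M (n + 1)) : r (g n w) ≤ C * BalancedPower.family A M (n + 1) p w :=
    BalancedPower.le_mul_seminorm (r.comp (g n)) hC (fun x => by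
      rw [Seminorm.comp_apply, BalancedPower.lift_tprod]
      exact h n x) w
  have hgc (n : ℕ) : Continuous (g n) :=
    continuous_of_forall_seminorm_le (g n) fun r hr => by
      obtain ⟨C, hC, q, p, -, -, h⟩ := hb r hr
      exact ⟨C, _, BalancedPower.continuous_family A M (n + 1) p, hg n hC h⟩
  let G (n : ℕ) := completionLift (g n) (hgc n)
  have hG (n : ℕ) {r : Seminorm ℂ Y} (hr : Continuous r) {C : ℝ} (hC : 0 ≤ C)
      {p : {p : Seminorm ℂ M // Continuous p}} (h : ∀ n x, r (f n x) ≤ C * ∏ i, p.1 (x i))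
      (w : CompletedPower A M (n + 1)) :
      r (G n w) ≤ C * (CompletedPower.seminorm A M p (n + 1) w *
        (((⟨1, one_pos⟩ : {ρ : ℝ // 0 < ρ}) : ℝ)) ^ (n + 1)) := by
    rw [one_pow, mul_one]
    refine completionSeminorm_comp_le _ _ r hr (G n) (fun w => ?_) w
    rw [completionLift_coe]
    exact hg n hC h w
  have hsum (t : AnalyticTensorPos A M) : Summable fun n => G n (t.1 n) :=
    summable_of_summable_seminorm fun r hr => by
      obtain ⟨C, hC, q, p, -, -, h⟩ := hb r hr
      exact Summable.of_nonneg_of_le (fun n => apply_nonneg _ _) (fun n => hG n hr hC h _)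
        ((t.summable (p, ⟨1, one_pos⟩)).mul_left C)
  let S : AnalyticTensorPos A M →ₗ[ℂ] Y :=
    { toFun := fun t => ∑' n, G n (t.1 n)
      map_add' := fun t u => by
        rw [← (hsum t).tsum_add (hsum u)]
        exact tsum_congr fun n => map_add (G n) _ _
      map_smul' := fun c t => by
        rw [RingHom.id_apply, ← (hsum t).tsum_const_smul]
        exact tsum_congr fun n => map_smul (G n) _ _ }
  have hS {r : Seminorm ℂ Y} (hr : Continuous r) {C : ℝ} (hC : 0 ≤ C)
      {p : {p : Seminorm ℂ M // Continuous p}} (h : ∀ n x, r (f n x) ≤ C * ∏ i, p.1 (x i))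
      (t : AnalyticTensorPos A M) :
      r (S t) ≤ C * AnalyticTensorPos.seminorm A M (p, ⟨1, one_pos⟩) t := by
    rw [AnalyticTensorPos.seminorm_apply, ← tsum_mul_left]
    exact seminorm_tsum_le (hsum t) hr ((t.summable (p, ⟨1, one_pos⟩)).mul_left C)
      fun n => hG n hr hC h _
  let F : AnalyticTensor A M →ₗ[ℂ] Y := f₀.coprod S
  have hF (r : Seminorm ℂ Y) (hr : Continuous r) (C : ℝ) (hC : 0 ≤ C)
      (q : Seminorm ℂ A) (p : {p : Seminorm ℂ M // Continuous p}) (h₀ : ∀ a, r (f₀ a) ≤ C * q a)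
      (h : ∀ n x, r (f n x) ≤ C * ∏ i, p.1 (x i)) (z : AnalyticTensor A M) :
      r (F z) ≤ C * seminorm q p z := by
    rw [seminorm_apply, mul_add, LinearMap.coprod_apply]
    exact (map_add_le_add r _ _).trans (add_le_add (h₀ _) (hS hr hC h _))
  refine ⟨⟨F, continuous_of_forall_seminorm_le F fun r hr => ?_⟩, fun a => ?_, fun n x => ?_, hF⟩
  · obtain ⟨C, hC, q, p, hq, h₀, h⟩ := hb r hr
    exact ⟨C, _, continuous_seminorm hq p, hF r hr C hC q p h₀ h⟩
  · change f₀ a + S 0 = f₀ a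
    rw [map_zero, add_zero]
  · have hval (k : ℕ) : G k ((tensor A n x).2.1 k) = G k ((Pi.single n
        ((BalancedPower.tprod A x : BalancedPower A M (n + 1)) : CompletedPower A M (n + 1)) :
          ∀ n, CompletedPower A M (n + 1)) k) := rfl
    change f₀ 0 + ∑' k, G k ((tensor A n x).2.1 k) = f n x
    rw [map_zero, zero_add, tsum_eq_single n fun k hk => ?_]
    · rw [hval, Pi.single_eq_same, completionLift_coe]
      exact BalancedPower.lift_tprod _ _ _
    · rw [hval, Pi.single_eq_of_ne hk, map_zero]

end AnalyticTensor

end HatTensor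

theorem Seminorm.le_of_forall_lt_one {E : Type*} [AddCommGroup E] [Module ℂ E]
    {p r : Seminorm ℂ E} (h : ∀ x, p x < 1 → r x < 1) (x : E) : r x ≤ p x := by
  refine le_of_forall_pos_le_add fun ε hε => ?_
  have hpos : 0 < p x + ε := by linarith [apply_nonneg p x]
  have hn : ‖((p x + ε : ℝ) : ℂ)⁻¹‖ = (p x + ε)⁻¹ := by
    rw [norm_inv, Complex.norm_real, Real.norm_of_nonneg hpos.le]
  have := h (((p x + ε : ℝ) : ℂ)⁻¹ • x) (by
    rw [map_smul_eq_mul, hn, inv_mul_lt_iff₀ hpos]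
    linarith)
  rw [map_smul_eq_mul, hn, inv_mul_lt_iff₀ hpos, mul_one] at this
  exact this.le

namespace HatTensor

theorem exists_continuous_seminorms_bilinear_le {E F G : Type*} [AddCommGroup E] [Module ℂ E]
    [TopologicalSpace E] [PolynormableSpace ℂ E] [AddCommGroup F] [Module ℂ F] [TopologicalSpace F]
    [PolynormableSpace ℂ F] [AddCommGroup G] [Module ℂ G] [TopologicalSpace G]
    (f : E →ₗ[ℂ] F →ₗ[ℂ] G) (hf : Continuous fun z : E × F => f z.1 z.2) {r : Seminorm ℂ G}
    (hr : Continuous r) : ∃ (q : Seminorm ℂ E) (p : Seminorm ℂ F), Continuous q ∧ Continuous p ∧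
      ∀ x y, r (f x y) ≤ q x * p y := by
  have hU : {z : E × F | r (f z.1 z.2) < 1} ∈ 𝓝 ((0 : E), (0 : F)) :=
    (hr.comp hf).continuousAt.preimage_mem_nhds (t := Set.Iio 1)
      (by simpa using Iio_mem_nhds one_pos)
  rw [nhds_prod_eq] at hU
  obtain ⟨U, hU, V, hV, hUV⟩ := Filter.mem_prod_iff.1 hU
  obtain ⟨q, hq, hqU⟩ := exists_continuous_seminorm_of_mem_nhds hU
  obtain ⟨p, hp, hpV⟩ := exists_continuous_seminorm_of_mem_nhds hV
  have h1 {x : E} (hx : q x < 1) (y : F) : r (f x y) ≤ p y :=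
    Seminorm.le_of_forall_lt_one (p := p) (r := r.comp (f x))
      (fun y hy => hUV (Set.mk_mem_prod (hqU x hx) (hpV y hy))) y
  refine ⟨q, p, hq, hp, fun x y => ?_⟩
  refine le_of_forall_pos_le_add fun ε hε => ?_
  have hδ : 0 < ε / (p y + 1) := div_pos hε (by linarith [apply_nonneg p y])
  set δ := ε / (p y + 1)
  have hpos : 0 < q x + δ := by linarith [apply_nonneg q x]
  have hn : ‖((q x + δ : ℝ) : ℂ)⁻¹‖ = (q x + δ)⁻¹ := by
    rw [norm_inv, Complex.norm_real, Real.norm_of_nonneg hpos.le]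
  have := h1 (x := ((q x + δ : ℝ) : ℂ)⁻¹ • x) (by
    rw [map_smul_eq_mul, hn, inv_mul_lt_iff₀ hpos]
    linarith) y
  rw [map_smul, LinearMap.smul_apply, map_smul_eq_mul, hn, inv_mul_le_iff₀ hpos, add_mul] at this
  have h2 : δ * p y ≤ ε := by
    rw [div_mul_eq_mul_div, div_le_iff₀ (by linarith [apply_nonneg p y])]
    nlinarith
  linarith

end HatTensor

open HatTensor

section ArensMichael

variable {A : Type*} [Ring A] [Algebra ℂ A]

/-- A seminorm on an algebra is submultiplicative. -/
def Seminorm.IsSubmultiplicative (p : Seminorm ℂ A) : Prop := ∀ a b, p (a * b) ≤ p a * p b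

theorem Seminorm.IsSubmultiplicative.smul {p : Seminorm ℂ A} (hp : p.IsSubmultiplicative)
    {c : NNReal} (hc : 1 ≤ c) : (c • p).IsSubmultiplicative := fun a b => by
  have hc' : (1 : ℝ) ≤ c := hc
  simp only [smul_apply, NNReal.smul_def, smul_eq_mul]
  calc (c : ℝ) * p (a * b) ≤ c * (p a * p b) := by gcongr; exact hp a b
    _ ≤ c * (c * (p a * p b)) := le_mul_of_one_le_left
        (mul_nonneg (by positivity) (mul_nonneg (apply_nonneg _ _) (apply_nonneg _ _))) hc'
    _ = c * p a * (c * p b) := by ring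

theorem Seminorm.IsSubmultiplicative.finset_sup {ι : Type*} {p : ι → Seminorm ℂ A} {s : Finset ι}
    (hp : ∀ i ∈ s, (p i).IsSubmultiplicative) : (s.sup p).IsSubmultiplicative := fun a b =>
  Seminorm.finset_sup_apply_le (mul_nonneg (apply_nonneg _ _) (apply_nonneg _ _)) fun i hi =>
    (hp i hi a b).trans (mul_le_mul (Seminorm.le_finset_sup_apply hi)
      (Seminorm.le_finset_sup_apply hi) (apply_nonneg _ _) (apply_nonneg _ _))

variable [UniformSpace A]

theorem ArensMichaelAlgebra.of_submultiplicative [IsUniformAddGroup A] [CompleteSpace A]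
    [T2Space A] (h : ∀ U ∈ 𝓝 (0 : A), ∃ p : Seminorm ℂ A, Continuous p ∧ p.IsSubmultiplicative ∧
      ∀ x, p x < 1 → x ∈ U) : ArensMichaelAlgebra A where
  exists_submultiplicative := by
    refine ⟨{p | Continuous p ∧ p.IsSubmultiplicative}, fun p hp => hp.2,
      (SeminormFamily.withSeminorms_iff_nhds_eq_iInf _).2 (le_antisymm ?_ fun U hU => ?_)⟩
    · refine le_iInf fun p => Filter.map_le_iff_le_comap.1 ?_
      have := p.2.1.tendsto 0
      rwa [map_zero] at this
    · obtain ⟨p, hp, hps, hpU⟩ := h U hU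
      exact Filter.mem_iInf_of_mem (⟨p, hp, hps⟩ : {p : Seminorm ℂ A | Continuous p ∧ p.IsSubmultiplicative})
        (Filter.mem_of_superset (Filter.preimage_mem_comap (Iio_mem_nhds one_pos)) fun x hx => hpU x hx)

variable [ArensMichaelAlgebra A]

instance ArensMichaelAlgebra.polynormableSpace : PolynormableSpace ℂ A :=
  let ⟨_, _, h⟩ := ArensMichaelAlgebra.exists_submultiplicative (A := A)
  h.toPolynormableSpace

instance ArensMichaelAlgebra.continuousSMul : ContinuousSMul ℂ A :=
  (PolynormableSpace.withSeminorms ℂ A).continuousSMul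

theorem ArensMichaelAlgebra.exists_submultiplicative_ge {r : Seminorm ℂ A} (hr : Continuous r) :
    ∃ q : Seminorm ℂ A, Continuous q ∧ q.IsSubmultiplicative ∧ ∀ a, r a ≤ q a := by
  obtain ⟨P, hP, h⟩ := ArensMichaelAlgebra.exists_submultiplicative (A := A)
  obtain ⟨s, δ, hδ, hs⟩ := (h.mem_nhds_iff 0 {x | r x < 1}).1
    (hr.continuousAt.preimage_mem_nhds (t := Set.Iio 1) (by simpa using Iio_mem_nhds one_pos))
  have hsub : (s.sup fun p : P => (p : Seminorm ℂ A)).IsSubmultiplicative :=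
    .finset_sup fun p _ => hP p p.2
  refine ⟨max 1 (Real.toNNReal δ⁻¹) • s.sup fun p : P => (p : Seminorm ℂ A),
    continuous_smul_seminorm (h.finset_sups.continuous_seminorm s) _, hsub.smul (le_max_left _ _),
    Seminorm.le_of_forall_lt_one fun x hx => hs ?_⟩
  rw [Seminorm.mem_ball_zero]
  rw [smul_apply, NNReal.smul_def, smul_eq_mul] at hx
  have h1 : δ⁻¹ * (s.sup fun p : P => (p : Seminorm ℂ A)) x < 1 :=
    (mul_le_mul_of_nonneg_right ((Real.le_coe_toNNReal _).trans
      (NNReal.coe_le_coe.2 (le_max_right _ _))) (apply_nonneg _ _)).trans_lt hx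
  rwa [inv_mul_lt_iff₀ hδ, mul_one] at h1

instance ArensMichaelAlgebra.isTopologicalRing : IsTopologicalRing A where
  continuous_mul := by
    refine continuous_iff_continuousAt.2 fun ⟨a, b⟩ => ?_
    obtain ⟨P, hP, h⟩ := ArensMichaelAlgebra.exists_submultiplicative (A := A)
    refine (h.tendsto_nhds' _ _).2 fun s ε hε => ?_
    set p := s.sup fun p : P => (p : Seminorm ℂ A)
    have hp : p.IsSubmultiplicative := .finset_sup fun p _ => hP p p.2
    have hpc : Continuous p := h.finset_sups.continuous_seminorm s
    have hlim : Filter.Tendsto (fun z : A × A => p (z.1 - a) * p z.2 + p a * p (z.2 - b))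
        (𝓝 (a, b)) (𝓝 0) := by
      have : Continuous fun z : A × A => p (z.1 - a) * p z.2 + p a * p (z.2 - b) := by fun_prop
      simpa using this.tendsto (a, b)
    filter_upwards [hlim.eventually_lt_const hε] with z hz
    refine lt_of_le_of_lt ?_ hz
    have : z.1 * z.2 - a * b = (z.1 - a) * z.2 + a * (z.2 - b) := by noncomm_ring
    rw [this]
    exact (map_add_le_add p _ _).trans (add_le_add (hp _ _) (hp _ _))

end ArensMichael

namespace HatBimodule

attribute [instance] HatBimodule.isScalarTower_left HatBimodule.isScalarTower_right
  HatBimodule.smulCommClass HatBimodule.continuousSMul_left HatBimodule.continuousSMul_right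

variable (A : Type*) {M : Type*} [Ring A] [Algebra ℂ A] [UniformSpace A]
  [AddCommGroup M] [Module ℂ M] [Module A M] [Module Aᵐᵒᵖ M] [UniformSpace M]

section

variable [HatBimodule A M]

instance smulCommClass_complex_left : SMulCommClass A ℂ M :=
  IsScalarTower.to_smulCommClass'

instance smulCommClass_complex_right : SMulCommClass Aᵐᵒᵖ ℂ M :=
  IsScalarTower.to_smulCommClass'

variable (M) in
/-- The left action as a bilinear map. -/
def leftAction : A →ₗ[ℂ] M →ₗ[ℂ] M :=
  LinearMap.mk₂ ℂ (fun a x => a • x) (fun _ _ _ => add_smul _ _ _) (fun _ _ _ => smul_assoc _ _ _)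
    (fun _ _ _ => smul_add _ _ _) fun _ _ _ => smul_comm _ _ _

variable (M) in
/-- The right action as a bilinear map. -/
def rightAction : A →ₗ[ℂ] M →ₗ[ℂ] M :=
  LinearMap.mk₂ ℂ (fun a x => MulOpposite.op a • x)
    (fun _ _ _ => by rw [MulOpposite.op_add, add_smul])
    (fun _ _ _ => by rw [MulOpposite.op_smul, smul_assoc])
    (fun _ _ _ => smul_add _ _ _) fun _ _ _ => smul_comm _ _ _

end

variable {A}

/-- Seminorms on `A` and on a bimodule for which multiplication and both actions are
contractive. -/
structure IsCompatible (q : Seminorm ℂ A) (p : Seminorm ℂ M) : Prop where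
  mul_le : ∀ a b, q (a * b) ≤ q a * q b
  smul_le : ∀ (a : A) (x : M), p (a • x) ≤ q a * p x
  op_smul_le : ∀ (a : A) (x : M), p (MulOpposite.op a • x) ≤ p x * q a

theorem exists_isCompatible_ge [ArensMichaelAlgebra A] [HatBimodule A M] {q₀ : Seminorm ℂ A}
    (hq₀ : Continuous q₀) {p₀ : Seminorm ℂ M} (hp₀ : Continuous p₀) :
    ∃ (q : Seminorm ℂ A) (p : Seminorm ℂ M), Continuous q ∧ Continuous p ∧ IsCompatible q p ∧
      (∀ a, q₀ a ≤ q a) ∧ ∀ x, p₀ x ≤ p x := by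
  have := HatBimodule.isUniformAddGroup A (M := M)
  have := HatBimodule.locallyConvex A (M := M)
  obtain ⟨q₁, p₁, hq₁, hp₁, h₁⟩ := exists_continuous_seminorms_bilinear_le (leftAction A M)
    (continuous_fst.smul continuous_snd) hp₀
  obtain ⟨q₂, p₂, hq₂, hp₂, h₂⟩ := exists_continuous_seminorms_bilinear_le (rightAction A M)
    ((MulOpposite.continuous_op.comp continuous_fst).smul continuous_snd) hp₁
  obtain ⟨q, hq, hqs, hqle⟩ := ArensMichaelAlgebra.exists_submultiplicative_ge
    (continuous_sup_seminorm (continuous_sup_seminorm hq₀ hq₁) hq₂)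
  have hle₀ (a : A) : q₀ a ≤ q a := (le_sup_left.trans le_sup_left).trans (hqle a)
  have hle₁ (a : A) : q₁ a ≤ q a := (le_sup_right.trans le_sup_left).trans (hqle a)
  have hle₂ (a : A) : q₂ a ≤ q a := le_sup_right.trans (hqle a)
  let t : A × M × A → M := fun z => z.1 • MulOpposite.op z.2.2 • z.2.1
  let c : A × M × A → ℝ := fun z => q z.1 * p₂ z.2.1 * q z.2.2
  have hc (z : A × M × A) : 0 ≤ c z :=
    mul_nonneg (mul_nonneg (apply_nonneg _ _) (apply_nonneg _ _)) (apply_nonneg _ _)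
  have ht1 (x : M) : t (1, x, 1) = x := by simp [t]
  have ht : Submodule.span ℂ (Set.range t) = ⊤ :=
    Submodule.eq_top_iff'.2 fun x => Submodule.subset_span ⟨_, ht1 x⟩
  refine ⟨q, infSeminorm t c hc ht, hq, ?_, ⟨hqs, fun a x => ?_, fun a x => ?_⟩, hle₀, fun x => ?_⟩
  · refine continuous_seminorm_of_le
      (continuous_smul_seminorm hp₂ (Real.toNNReal (q 1 * q 1))) fun x => ?_
    rw [smul_apply, NNReal.smul_def, smul_eq_mul,
      Real.coe_toNNReal _ (mul_nonneg (apply_nonneg _ _) (apply_nonneg _ _))]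
    calc infSeminorm t c hc ht x = infSeminorm t c hc ht (t (1, x, 1)) := by rw [ht1]
      _ ≤ c (1, x, 1) := infSeminorm_apply_le _
      _ = q 1 * q 1 * p₂ x := by simp only [c]; ring
  · refine le_mul_infSeminorm ((infSeminorm t c hc ht).comp (leftAction A M a))
      (apply_nonneg q a) (fun z => ?_) x
    have : leftAction A M a (t z) = t (a * z.1, z.2) := (mul_smul a _ _).symm
    rw [Seminorm.comp_apply, this]
    refine (infSeminorm_apply_le _).trans ?_
    change q (a * z.1) * p₂ z.2.1 * q z.2.2 ≤ q a * (q z.1 * p₂ z.2.1 * q z.2.2)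
    rw [← mul_assoc, ← mul_assoc]
    exact mul_le_mul_of_nonneg_right (mul_le_mul_of_nonneg_right (hqs _ _) (apply_nonneg _ _))
      (apply_nonneg _ _)
  · rw [mul_comm]
    refine le_mul_infSeminorm ((infSeminorm t c hc ht).comp (rightAction A M a))
      (apply_nonneg q a) (fun z => ?_) x
    have : rightAction A M a (t z) = t (z.1, z.2.1, z.2.2 * a) := by
      change MulOpposite.op a • z.1 • MulOpposite.op z.2.2 • z.2.1 =
        z.1 • MulOpposite.op (z.2.2 * a) • z.2.1
      rw [MulOpposite.op_mul, mul_smul, ← smul_comm z.1]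
    rw [Seminorm.comp_apply, this]
    refine (infSeminorm_apply_le _).trans ?_
    change q z.1 * p₂ z.2.1 * q (z.2.2 * a) ≤ q a * (q z.1 * p₂ z.2.1 * q z.2.2)
    rw [mul_comm (q a), mul_assoc _ (q z.2.2)]
    exact mul_le_mul_of_nonneg_left (hqs _ _) (mul_nonneg (apply_nonneg _ _) (apply_nonneg _ _))
  · rw [← one_mul (infSeminorm t c hc ht x)]
    refine le_mul_infSeminorm p₀ zero_le_one (fun z => ?_) x
    rw [one_mul]
    refine (h₁ z.1 _).trans ?_
    change _ ≤ q z.1 * p₂ z.2.1 * q z.2.2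
    rw [mul_assoc]
    refine mul_le_mul (hle₁ _) ((h₂ z.2.2 z.2.1).trans ?_) (apply_nonneg _ _) (apply_nonneg _ _)
    rw [mul_comm]
    exact mul_le_mul_of_nonneg_left (hle₂ _) (apply_nonneg _ _)

variable {N : Type*} [AddCommGroup N] [Module ℂ N] [Module A N] [Module Aᵐᵒᵖ N] [UniformSpace N]

instance prod [HatBimodule A M] [HatBimodule A N] : HatBimodule A (M × N) where
  isUniformAddGroup :=
    have := HatBimodule.isUniformAddGroup A (M := M)
    have := HatBimodule.isUniformAddGroup A (M := N)
    inferInstance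
  completeSpace :=
    have := HatBimodule.completeSpace A (M := M)
    have := HatBimodule.completeSpace A (M := N)
    inferInstance
  t2Space :=
    have := HatBimodule.t2Space A (M := M)
    have := HatBimodule.t2Space A (M := N)
    inferInstance
  continuousSMul :=
    have := HatBimodule.continuousSMul A (M := M)
    have := HatBimodule.continuousSMul A (M := N)
    inferInstance
  locallyConvex :=
    have := HatBimodule.locallyConvex A (M := M)
    have := HatBimodule.locallyConvex A (M := N)
    inferInstance
  isScalarTower_left := inferInstance
  isScalarTower_right := inferInstance
  smulCommClass := inferInstance
  continuousSMul_left := inferInstance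
  continuousSMul_right := inferInstance

end HatBimodule

namespace HatTensor

section Scaling

variable {A M : Type*} [Ring A]
  [AddCommGroup M] [Module ℂ M] [Module A M] [Module Aᵐᵒᵖ M] [TopologicalSpace M]

theorem AnalyticTensorPos.mul_seminorm_le {p p' : {p : Seminorm ℂ M // Continuous p}} {C : ℝ}
    (hC : 1 ≤ C) {ρ : {ρ : ℝ // 0 < ρ}} (h : ∀ x, p.1 x * (C * ρ) ≤ p'.1 x)
    (t : AnalyticTensorPos A M) : C * AnalyticTensorPos.seminorm A M (p, ρ) t ≤
      AnalyticTensorPos.seminorm A M (p', ⟨1, one_pos⟩) t := by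
  have hρ : (0 : ℝ) < ρ := ρ.2
  rw [AnalyticTensorPos.seminorm_apply, AnalyticTensorPos.seminorm_apply, ← tsum_mul_left]
  refine ((t.summable (p, ρ)).mul_left C).tsum_le_tsum (fun n => ?_)
    (t.summable (p', ⟨1, one_pos⟩))
  rw [one_pow, mul_one]
  refine le_trans ?_ (CompletedPower.seminorm_mul_pow_le A (by positivity) h (n + 1) (t.1 n))
  rw [mul_left_comm, mul_pow]
  refine mul_le_mul_of_nonneg_left (mul_le_mul_of_nonneg_right ?_ (by positivity))
    (apply_nonneg _ _)
  exact le_self_pow₀ hC n.succ_ne_zero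

theorem AnalyticTensorPos.exists_seminorm_ge {r : Seminorm ℂ (AnalyticTensorPos A M)}
    (hr : Continuous r) : ∃ p : {p : Seminorm ℂ M // Continuous p},
      ∀ t, r t ≤ AnalyticTensorPos.seminorm A M (p, ⟨1, one_pos⟩) t := by
  obtain ⟨s, C, -, hC⟩ := Seminorm.bound_of_continuous (AnalyticTensorPos.withSeminorms A M) r hr
  set D : NNReal := max C 1
  have hD : (1 : ℝ) ≤ D := NNReal.coe_le_coe.2 (le_max_right C 1)
  have hCD : (C : ℝ) ≤ D := NNReal.coe_le_coe.2 (le_max_left C 1)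
  let g (i : {p : Seminorm ℂ M // Continuous p} × {ρ : ℝ // 0 < ρ}) : Seminorm ℂ M :=
    (D * Real.toNNReal i.2) • i.1.1
  have hg : Continuous ⇑(s.sup g) := continuous_finset_sup_seminorm fun i _ =>
    continuous_smul_seminorm i.1.2 (D * Real.toNNReal i.2)
  refine ⟨⟨s.sup g, hg⟩, fun t => (hC t).trans ?_⟩
  rw [← Seminorm.finset_sup_smul]
  refine Seminorm.finset_sup_apply_le (apply_nonneg _ _) fun i hi => ?_
  refine le_trans ?_ (mul_seminorm_le (p := i.1) (ρ := i.2) hD (fun x => ?_) t)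
  · exact mul_le_mul_of_nonneg_right hCD (apply_nonneg _ _)
  · refine le_trans (le_of_eq ?_) (Seminorm.le_finset_sup_apply (p := g) (x := x) hi)
    simp only [g, smul_apply, NNReal.smul_def, smul_eq_mul, NNReal.coe_mul,
      Real.coe_toNNReal _ i.2.2.le]
    ring

end Scaling

namespace AnalyticTensor

section Tensor

variable {A M : Type*} [Ring A]
  [AddCommGroup M] [Module ℂ M] [Module A M] [Module Aᵐᵒᵖ M] [TopologicalSpace M]

variable (A M) in
/-- The homogeneous elements of degree `n + 1` as a multilinear map. -/
def tensorMap [Algebra ℂ A] (n : ℕ) :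
    MultilinearMap ℂ (fun _ : Fin (n + 1) => M) (AnalyticTensor A M) :=
  (LinearMap.inr ℂ A (AnalyticTensorPos A M) ∘ₗ
    (AnalyticTensorPos.single A M n).toLinearMap ∘ₗ
      BalancedPower.toCompleted A M (n + 1)).compMultilinearMap
    (BalancedPower.tprodMap A (n + 1))

theorem tensorMap_apply [Algebra ℂ A] (n : ℕ) (x : Fin (n + 1) → M) :
    tensorMap A M n x = tensor A n x := rfl

variable (A M) in
/-- The elements of degree one as a linear map. -/
def genMap [Algebra ℂ A] : M →ₗ[ℂ] AnalyticTensor A M := (tensorMap A M 0).toLinearMap 0 0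

theorem genMap_apply [Algebra ℂ A] (x : M) : genMap A M x = gen A x :=
  congrArg (tensor A 0) (funext fun i => by rw [Subsingleton.elim (α := Fin 1) i 0, Function.update_self])

theorem base_add (a b : A) : base A (a + b) = base A a + base A (M := M) b := by simp [base]

theorem base_smul [Algebra ℂ A] (c : ℂ) (a : A) :
    base A (c • a) = c • base A (M := M) a := by simp [base]

theorem gen_add [Algebra ℂ A] (x y : M) : gen A (x + y) = gen A x + gen A y := by
  simp only [← genMap_apply, map_add]

theorem gen_smul [Algebra ℂ A] (c : ℂ) (x : M) : gen A (c • x) = c • gen A x := by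
  simp only [← genMap_apply, map_smul]

theorem isBalanced_tensorMap [Algebra ℂ A] (n : ℕ) : IsBalanced A (tensorMap A M n) :=
  fun x a i j hij => congrArg (fun w : BalancedPower A M (n + 1) =>
      ((0, AnalyticTensorPos.single A M n w) : AnalyticTensor A M))
    (BalancedPower.isBalanced_tprodMap A (n + 1) x a i j hij)

end Tensor

section Word

variable {A M R : Type*} [Ring A] [AddCommGroup M] [Module A M] [Module Aᵐᵒᵖ M] [Monoid R]

theorem prod_ofFn_balanced {θ : A → R} {γ : M → R} (h : ∀ a x, γ (a • x) = θ a * γ x)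
    (h' : ∀ a x, γ (MulOpposite.op a • x) = γ x * θ a) {n : ℕ} (x : Fin n → M) (a : A)
    (i j : Fin n) (hij : (j : ℕ) = i + 1) :
    (List.ofFn fun k => γ (Function.update x i (MulOpposite.op a • x i) k)).prod =
      (List.ofFn fun k => γ (Function.update x j (a • x j) k)).prod := by
  induction n with
  | zero => exact i.elim0
  | succ n ih =>
    obtain ⟨j, rfl⟩ := Fin.exists_succ_eq_of_ne_zero (x := j) (by
      rintro rfl
      simp at hij)
    have hj : (j : ℕ) = i := by simpa using hij
    have key (k : Fin n) (y : M) (l : Fin n) :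
        Function.update x k.succ y l.succ = Function.update (fun l => x l.succ) k y l :=
      congrFun (Function.update_comp_eq_of_injective x (Fin.succ_injective n) k y) l
    simp only [List.ofFn_succ, List.prod_cons, key]
    rw [Function.update_of_ne (Fin.succ_ne_zero j).symm]
    rcases Fin.eq_zero_or_eq_succ i with rfl | ⟨i, rfl⟩
    · obtain ⟨m, rfl⟩ : ∃ m, n = m + 1 := ⟨n - 1, by have := j.2; omega⟩
      have hj0 : j = 0 := Fin.ext hj
      subst hj0
      have h0 (y : M) (l : Fin (m + 1)) :
          Function.update x 0 y l.succ = x l.succ :=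
        Function.update_of_ne (Fin.succ_ne_zero l) _ _
      simp only [h0, List.ofFn_succ, List.prod_cons, Function.update_self, h', h]
      rw [mul_assoc, mul_assoc]
      simp [Function.update_of_ne]
    · simp only [key]
      rw [Function.update_of_ne (Fin.succ_ne_zero i).symm]
      rw [ih (fun l => x l.succ) i j (by simpa using hj)]

end Word

section Operators

variable {A M : Type*} [Ring A] [Algebra ℂ A] [UniformSpace A] [ArensMichaelAlgebra A]
  [AddCommGroup M] [Module ℂ M] [Module A M] [Module Aᵐᵒᵖ M] [UniformSpace M] [HatBimodule A M]

theorem exists_isCompatible_seminorm_ge {r : Seminorm ℂ (AnalyticTensor A M)} (hr : Continuous r) :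
    ∃ (q : Seminorm ℂ A) (p : {p : Seminorm ℂ M // Continuous p}), Continuous q ∧
      HatBimodule.IsCompatible q p.1 ∧ ∀ z, r z ≤ seminorm q p z := by
  obtain ⟨p₀, hp₀⟩ := AnalyticTensorPos.exists_seminorm_ge
    (r := r.comp (LinearMap.inr ℂ A (AnalyticTensorPos A M)))
    (hr.comp (continuous_const.prodMk continuous_id))
  have hq₀ : Continuous (r.comp (LinearMap.inl ℂ A (AnalyticTensorPos A M))) :=
    hr.comp (continuous_id.prodMk continuous_const)
  obtain ⟨q, p, hq, hp, hqp, hqle, hple⟩ := HatBimodule.exists_isCompatible_ge hq₀ p₀.2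
  refine ⟨q, ⟨p, hp⟩, hq, hqp, fun z => ?_⟩
  have hz : z = LinearMap.inl ℂ A (AnalyticTensorPos A M) z.1 +
      LinearMap.inr ℂ A (AnalyticTensorPos A M) z.2 := by simp
  rw [hz, seminorm_apply]
  simp only [LinearMap.inl_apply, LinearMap.inr_apply, Prod.fst_add, Prod.snd_add, add_zero,
    zero_add]
  refine (map_add_le_add r _ _).trans (add_le_add (hqle _) ((hp₀ z.2).trans ?_))
  rw [← one_mul (AnalyticTensorPos.seminorm A M (p₀, _) z.2)]
  exact AnalyticTensorPos.mul_seminorm_le le_rfl (fun x => by simpa using hple x) z.2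

omit [UniformSpace A] [ArensMichaelAlgebra A] [UniformSpace M] [HatBimodule A M] in
theorem _root_.HatBimodule.IsCompatible.prod_update_le {q : Seminorm ℂ A} {p : Seminorm ℂ M}
    (h : HatBimodule.IsCompatible q p) (a : A) {n : ℕ} (x : Fin (n + 1) → M) :
    ∏ i, p (Function.update x 0 (a • x 0) i) ≤ q a * ∏ i, p (x i) := by
  rw [Fin.prod_univ_succ, Fin.prod_univ_succ (fun i => p (x i)), ← mul_assoc, Function.update_self]
  simp only [Function.update_of_ne (Fin.succ_ne_zero _)]
  exact mul_le_mul_of_nonneg_right (h.smul_le _ _) (Finset.prod_nonneg fun _ _ => apply_nonneg _ _)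

variable (M) in
theorem exists_leftBase (a : A) : ∃ F : AnalyticTensor A M →L[ℂ] AnalyticTensor A M,
    (∀ b, F (base A b) = base A (a * b)) ∧
    (∀ n x, F (tensor A n x) = tensor A n (Function.update x 0 (a • x 0))) ∧
    ∀ (q : Seminorm ℂ A) (p : {p : Seminorm ℂ M // Continuous p}), Continuous q →
      HatBimodule.IsCompatible q p.1 → ∀ z, seminorm q p (F z) ≤ q a * seminorm q p z := by
  let f (n : ℕ) : MultilinearMap ℂ (fun _ : Fin (n + 1) => M) (AnalyticTensor A M) :=
    (tensorMap A M n).compLinearMap fun i =>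
      if i = 0 then HatBimodule.leftAction A M a else LinearMap.id
  have hf (n : ℕ) (x : Fin (n + 1) → M) :
      f n x = tensor A n (Function.update x 0 (a • x 0)) := by
    refine congrArg (tensor A n) (funext fun i => ?_)
    rcases eq_or_ne i 0 with rfl | hi
    · simp [HatBimodule.leftAction]
    · simp [hi]
  have hb {q : Seminorm ℂ A} {p : {p : Seminorm ℂ M // Continuous p}}
      (h : HatBimodule.IsCompatible q p.1) (n : ℕ) (x : Fin (n + 1) → M) :
      seminorm q p (f n x) ≤ q a * ∏ i, p.1 (x i) := by
    rw [hf]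
    exact (seminorm_tensor_le q p n _).trans (h.prod_update_le a x)
  have hb₀ {q : Seminorm ℂ A} {p : {p : Seminorm ℂ M // Continuous p}}
      (h : HatBimodule.IsCompatible q p.1) (b : A) :
      seminorm (M := M) q p ((LinearMap.inl ℂ A (AnalyticTensorPos A M) ∘ₗ LinearMap.mulLeft ℂ a) b)
        ≤ q a * q b :=
    (seminorm_base q p _).le.trans (h.mul_le a b)
  have hbal (n : ℕ) : IsBalanced A (f n) := fun x b i j hij => by
    have hj : j ≠ 0 := by
      rintro rfl
      simp at hij
    rw [hf, hf, Function.update_of_ne hj.symm, Function.update_comm hj]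
    have key := isBalanced_tensorMap n (Function.update x 0 (a • x 0)) b i j hij
    rw [tensorMap_apply, tensorMap_apply, Function.update_of_ne hj] at key
    rw [← key]
    congr 1
    rcases eq_or_ne i 0 with rfl | hi
    · simp [smul_comm]
    · rw [Function.update_comm hi, Function.update_of_ne hi, Function.update_of_ne hi.symm]
  obtain ⟨F, h₀, h, hF⟩ := exists_continuousLinearMap
    (LinearMap.inl ℂ A (AnalyticTensorPos A M) ∘ₗ LinearMap.mulLeft ℂ a) f hbal fun r hr => by
      obtain ⟨q, p, hq, hqp, hle⟩ := exists_isCompatible_seminorm_ge hr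
      exact ⟨q a, apply_nonneg _ _, q, p, hq, fun b => (hle _).trans (hb₀ hqp b),
        fun n x => (hle _).trans (hb hqp n x)⟩
  exact ⟨F, h₀, fun n x => (h n x).trans (hf n x), fun q p hq hqp =>
    hF _ (continuous_seminorm hq p) _ (apply_nonneg _ _) q p (hb₀ hqp) (hb hqp)⟩

theorem exists_leftGen (x : M) : ∃ F : AnalyticTensor A M →L[ℂ] AnalyticTensor A M,
    (∀ b, F (base A b) = gen A (MulOpposite.op b • x)) ∧
    (∀ n y, F (tensor A n y) = tensor A (n + 1) (Fin.cons x y)) ∧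
    ∀ (q : Seminorm ℂ A) (p : {p : Seminorm ℂ M // Continuous p}), Continuous q →
      HatBimodule.IsCompatible q p.1 → ∀ z, seminorm q p (F z) ≤ p.1 x * seminorm q p z := by
  let f (n : ℕ) : MultilinearMap ℂ (fun _ : Fin (n + 1) => M) (AnalyticTensor A M) :=
    (tensorMap A M (n + 1)).curryLeft x
  have hf (n : ℕ) (y : Fin (n + 1) → M) : f n y = tensor A (n + 1) (Fin.cons x y) := rfl
  let f₀ : A →ₗ[ℂ] AnalyticTensor A M := genMap A M ∘ₗ (HatBimodule.rightAction A M).flip x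
  have hf₀ (b : A) : f₀ b = gen A (MulOpposite.op b • x) :=
    genMap_apply (MulOpposite.op b • x)
  have hb {q : Seminorm ℂ A} {p : {p : Seminorm ℂ M // Continuous p}}
      (n : ℕ) (y : Fin (n + 1) → M) :
      seminorm q p (f n y) ≤ p.1 x * ∏ i, p.1 (y i) := by
    rw [hf]
    refine (seminorm_tensor_le q p _ _).trans (le_of_eq ?_)
    rw [Fin.prod_univ_succ]
    simp
  have hb₀ {q : Seminorm ℂ A} {p : {p : Seminorm ℂ M // Continuous p}}
      (h : HatBimodule.IsCompatible q p.1) (b : A) : seminorm q p (f₀ b) ≤ p.1 x * q b := by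
    rw [hf₀]
    refine (seminorm_tensor_le q p _ _).trans ?_
    rw [Fin.prod_univ_one]
    exact h.op_smul_le b x
  have hbal (n : ℕ) : IsBalanced A (f n) := fun y b i j hij => by
    have key := isBalanced_tensorMap (A := A) (n + 1) (Fin.cons x y) b i.succ j.succ (by simpa)
    rwa [← Fin.cons_update, ← Fin.cons_update, Fin.cons_succ, Fin.cons_succ] at key
  obtain ⟨F, h₀, h, hF⟩ := exists_continuousLinearMap f₀ f hbal fun r hr => by
      obtain ⟨q, p, hq, hqp, hle⟩ := exists_isCompatible_seminorm_ge hr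
      exact ⟨p.1 x, apply_nonneg _ _, q, p, hq, fun b => (hle _).trans (hb₀ hqp b),
        fun n x => (hle _).trans (hb n x)⟩
  exact ⟨F, fun b => (h₀ b).trans (hf₀ b), fun n x => (h n x).trans (hf n x), fun q p hq hqp =>
    hF _ (continuous_seminorm hq p) _ (apply_nonneg _ _) q p (hb₀ hqp) hb⟩

end Operators

end AnalyticTensor

/-- A locally convex space with linear operators `θ a` and `γ x` that satisfy the relations of the
tensor algebra and suitable bounds. -/
structure AnalyticRep (A M Y : Type*) [Ring A] [Algebra ℂ A] [TopologicalSpace A]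
    [AddCommGroup M] [Module ℂ M] [Module A M] [Module Aᵐᵒᵖ M] [TopologicalSpace M]
    [AddCommGroup Y] [Module ℂ Y] [TopologicalSpace Y] where
  θ : A →ₗ[ℂ] Module.End ℂ Y
  γ : M →ₗ[ℂ] Module.End ℂ Y
  θ_one : θ 1 = 1
  θ_mul : ∀ a b, θ (a * b) = θ a * θ b
  γ_smul : ∀ (a : A) (x : M), γ (a • x) = θ a * γ x
  γ_op_smul : ∀ (a : A) (x : M), γ (MulOpposite.op a • x) = γ x * θ a
  bound : ∀ r : Seminorm ℂ Y, Continuous r → ∃ r' : Seminorm ℂ Y, Continuous r' ∧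
    (∀ y, r y ≤ r' y) ∧ ∃ (q : Seminorm ℂ A) (p : {p : Seminorm ℂ M // Continuous p}),
      Continuous q ∧ (∀ a y, r' (θ a y) ≤ q a * r' y) ∧ ∀ x y, r' (γ x y) ≤ p.1 x * r' y

namespace AnalyticRep

variable {A M Y : Type*} [Ring A] [Algebra ℂ A]
  [AddCommGroup M] [Module ℂ M] [Module A M] [Module Aᵐᵒᵖ M]
  [AddCommGroup Y] [Module ℂ Y]

section Basic

variable [TopologicalSpace A] [TopologicalSpace M] [TopologicalSpace Y]
  [IsTopologicalAddGroup Y] [PolynormableSpace ℂ Y] (ρ : AnalyticRep A M Y)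

theorem continuous_θ (a : A) : Continuous (ρ.θ a) := by
  have : ContinuousSMul ℂ Y := (PolynormableSpace.withSeminorms ℂ Y).continuousSMul
  refine continuous_of_forall_seminorm_le (ρ.θ a) fun r hr => ?_
  obtain ⟨r', hr', hle, q, p, -, h, -⟩ := ρ.bound r hr
  exact ⟨q a, r', hr', fun y => (hle _).trans (h a y)⟩

theorem continuous_γ (x : M) : Continuous (ρ.γ x) := by
  have : ContinuousSMul ℂ Y := (PolynormableSpace.withSeminorms ℂ Y).continuousSMul
  refine continuous_of_forall_seminorm_le (ρ.γ x) fun r hr => ?_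
  obtain ⟨r', hr', hle, q, p, -, -, h⟩ := ρ.bound r hr
  exact ⟨p.1 x, r', hr', fun y => (hle _).trans (h x y)⟩

omit [IsTopologicalAddGroup Y] [PolynormableSpace ℂ Y] in
theorem seminorm_word_le {r : Seminorm ℂ Y} {p : Seminorm ℂ M}
    (h : ∀ x y, r (ρ.γ x y) ≤ p x * r y) {n : ℕ} (x : Fin n → M) (y : Y) :
    r ((List.ofFn fun i => ρ.γ (x i)).prod y) ≤ r y * ∏ i, p (x i) := by
  induction n with
  | zero => simp
  | succ n ih =>
    rw [List.ofFn_succ, List.prod_cons, Module.End.mul_apply, Fin.prod_univ_succ, mul_left_comm]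
    exact (h _ _).trans (mul_le_mul_of_nonneg_left (ih _) (apply_nonneg _ _))

/-- The multilinear map `x ↦ γ(x₀) ⋯ γ(xₙ) y`. -/
def word (y : Y) (n : ℕ) : MultilinearMap ℂ (fun _ : Fin (n + 1) => M) Y :=
  (LinearMap.applyₗ y : Module.End ℂ Y →ₗ[ℂ] Y).compMultilinearMap
    ((MultilinearMap.mkPiAlgebraFin ℂ (n + 1) (Module.End ℂ Y)).compLinearMap fun _ => ρ.γ)

omit [IsTopologicalAddGroup Y] [PolynormableSpace ℂ Y] in
theorem word_apply (y : Y) (n : ℕ) (x : Fin (n + 1) → M) :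
    ρ.word y n x = (List.ofFn fun i => ρ.γ (x i)).prod y := by
  simp [word]

end Basic

variable [UniformSpace A] [ArensMichaelAlgebra A] [TopologicalSpace M]
  [UniformSpace Y] [IsUniformAddGroup Y] [PolynormableSpace ℂ Y] [CompleteSpace Y] [T2Space Y]
  (ρ : AnalyticRep A M Y)

theorem exists_act (y : Y) : ∃ F : AnalyticTensor A M →L[ℂ] Y,
    (∀ a, F (AnalyticTensor.base A a) = ρ.θ a y) ∧
    (∀ n x, F (AnalyticTensor.tensor A n x) = (List.ofFn fun i => ρ.γ (x i)).prod y) ∧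
    ∀ r : Seminorm ℂ Y, Continuous r → ∀ (q : Seminorm ℂ A)
      (p : {p : Seminorm ℂ M // Continuous p}), (∀ a y, r (ρ.θ a y) ≤ q a * r y) →
      (∀ x y, r (ρ.γ x y) ≤ p.1 x * r y) →
      ∀ z, r (F z) ≤ r y * AnalyticTensor.seminorm q p z := by
  obtain ⟨F, h₀, h, hF⟩ := AnalyticTensor.exists_continuousLinearMap (LinearMap.applyₗ y ∘ₗ ρ.θ)
    (ρ.word y) (fun n x a i j hij => by
      rw [word_apply, word_apply]
      exact LinearMap.congr_fun
        (AnalyticTensor.prod_ofFn_balanced (θ := ρ.θ) ρ.γ_smul ρ.γ_op_smul x a i j hij) y)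
    fun r hr => by
      obtain ⟨r', hr', hle, q, p, hq, hqr, hpr⟩ := ρ.bound r hr
      refine ⟨r' y, apply_nonneg _ _, q, p, hq, fun a => (hle _).trans ?_,
        fun n x => (hle _).trans ?_⟩
      · rw [mul_comm]
        exact hqr a y
      · rw [word_apply]
        exact ρ.seminorm_word_le hpr x y
  refine ⟨F, h₀, fun n x => (h n x).trans (ρ.word_apply y n x), fun r hr q p hqr hpr =>
    hF r hr _ (apply_nonneg _ _) q p (fun a => ?_) fun n x => ?_⟩
  · rw [mul_comm]
    exact hqr a y
  · rw [word_apply]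
    exact ρ.seminorm_word_le hpr x y

/-- The action of the analytic tensor algebra on the vector `y` of a representation. -/
def act (y : Y) : AnalyticTensor A M →L[ℂ] Y := (ρ.exists_act y).choose

theorem act_base (y : Y) (a : A) : ρ.act y (AnalyticTensor.base A a) = ρ.θ a y :=
  (ρ.exists_act y).choose_spec.1 a

theorem act_tensor (y : Y) (n : ℕ) (x : Fin (n + 1) → M) :
    ρ.act y (AnalyticTensor.tensor A n x) = (List.ofFn fun i => ρ.γ (x i)).prod y :=
  (ρ.exists_act y).choose_spec.2.1 n x

theorem act_gen (y : Y) (x : M) : ρ.act y (AnalyticTensor.gen A x) = ρ.γ x y :=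
  (ρ.act_tensor y 0 fun _ => x).trans (by simp)

theorem seminorm_act_le {r : Seminorm ℂ Y} (hr : Continuous r) {q : Seminorm ℂ A}
    {p : {p : Seminorm ℂ M // Continuous p}} (hq : ∀ a y, r (ρ.θ a y) ≤ q a * r y)
    (hp : ∀ x y, r (ρ.γ x y) ≤ p.1 x * r y) (y : Y) (z : AnalyticTensor A M) :
    r (ρ.act y z) ≤ r y * AnalyticTensor.seminorm q p z :=
  (ρ.exists_act y).choose_spec.2.2 r hr q p hq hp z

theorem act_add (y y' : Y) (z : AnalyticTensor A M) :
    ρ.act (y + y') z = ρ.act y z + ρ.act y' z := by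
  have : ρ.act (y + y') = ρ.act y + ρ.act y' :=
    AnalyticTensor.continuousLinearMap_ext (fun a => by simp [act_base])
      fun n x => by simp [act_tensor]
  rw [this, add_apply]

theorem act_smul (c : ℂ) (y : Y) (z : AnalyticTensor A M) : ρ.act (c • y) z = c • ρ.act y z := by
  have : ContinuousSMul ℂ Y := (PolynormableSpace.withSeminorms ℂ Y).continuousSMul
  have : ρ.act (c • y) = c • ρ.act y :=
    AnalyticTensor.continuousLinearMap_ext (fun a => by simp [act_base])
      fun n x => by simp [act_tensor]
  rw [this, smul_apply]

end AnalyticRep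

namespace AnalyticTensor

section Regular

variable {A : Type*} (M : Type*) [Ring A] [Algebra ℂ A] [UniformSpace A] [ArensMichaelAlgebra A]
  [AddCommGroup M] [Module ℂ M] [Module A M] [Module Aᵐᵒᵖ M] [UniformSpace M] [HatBimodule A M]

/-- Left multiplication by an element of degree zero. -/
def leftBase (a : A) : AnalyticTensor A M →L[ℂ] AnalyticTensor A M := (exists_leftBase M a).choose

variable {M}

theorem leftBase_base (a b : A) : leftBase M a (base A b) = base A (a * b) :=
  (exists_leftBase M a).choose_spec.1 b

theorem leftBase_tensor (a : A) (n : ℕ) (x : Fin (n + 1) → M) :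
    leftBase M a (tensor A n x) = tensor A n (Function.update x 0 (a • x 0)) :=
  (exists_leftBase M a).choose_spec.2.1 n x

theorem seminorm_leftBase_le {q : Seminorm ℂ A} {p : {p : Seminorm ℂ M // Continuous p}}
    (hq : Continuous q) (h : HatBimodule.IsCompatible q p.1) (a : A) (z : AnalyticTensor A M) :
    seminorm q p (leftBase M a z) ≤ q a * seminorm q p z :=
  (exists_leftBase M a).choose_spec.2.2 q p hq h z

variable (A) in
/-- Left multiplication by an element of degree one. -/
def leftGen (x : M) : AnalyticTensor A M →L[ℂ] AnalyticTensor A M :=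
  (exists_leftGen (A := A) x).choose

theorem leftGen_base (x : M) (b : A) :
    leftGen A x (base A b) = gen A (MulOpposite.op b • x) :=
  (exists_leftGen x).choose_spec.1 b

theorem leftGen_tensor (x : M) (n : ℕ) (y : Fin (n + 1) → M) :
    leftGen A x (tensor A n y) = tensor A (n + 1) (Fin.cons x y) :=
  (exists_leftGen x).choose_spec.2.1 n y

theorem seminorm_leftGen_le {q : Seminorm ℂ A} {p : {p : Seminorm ℂ M // Continuous p}}
    (hq : Continuous q) (h : HatBimodule.IsCompatible q p.1) (x : M) (z : AnalyticTensor A M) :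
    seminorm q p (leftGen A x z) ≤ p.1 x * seminorm q p z :=
  (exists_leftGen x).choose_spec.2.2 q p hq h z

variable (A M) in
/-- The regular representation: left multiplication on the analytic tensor algebra. -/
def regularRep : AnalyticRep A M (AnalyticTensor A M) where
  θ :=
    { toFun := fun a => (leftBase M a).toLinearMap
      map_add' := fun a b => congrArg ContinuousLinearMap.toLinearMap
        (continuousLinearMap_ext (F := leftBase M (a + b)) (G := leftBase M a + leftBase M b)
          (fun c => by simp [leftBase_base, add_mul, base_add]) fun n x => by
            simp only [leftBase_tensor, add_apply, add_smul]
            exact (tensorMap A M n).map_update_add x 0 _ _)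
      map_smul' := fun c a => congrArg ContinuousLinearMap.toLinearMap
        (continuousLinearMap_ext (F := leftBase M (c • a)) (G := c • leftBase M a)
          (fun b => by simp [leftBase_base, base_smul]) fun n x => by
            simp only [leftBase_tensor, smul_apply, smul_assoc]
            exact (tensorMap A M n).map_update_smul x 0 _ _) }
  γ :=
    { toFun := fun x => (leftGen A x).toLinearMap
      map_add' := fun x y => congrArg ContinuousLinearMap.toLinearMap
        (continuousLinearMap_ext (F := leftGen A (x + y)) (G := leftGen A x + leftGen A y)
          (fun c => by simp [leftGen_base, gen_add]) fun n z => by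
            simp only [leftGen_tensor, add_apply]
            exact (tensorMap A M (n + 1)).cons_add z x y)
      map_smul' := fun c x => congrArg ContinuousLinearMap.toLinearMap
        (continuousLinearMap_ext (F := leftGen A (c • x)) (G := c • leftGen A x)
          (fun b => by simp [leftGen_base, gen_smul, smul_comm _ c]) fun n z => by
            simp only [leftGen_tensor, smul_apply]
            exact (tensorMap A M (n + 1)).cons_smul z c x) }
  θ_one := congrArg ContinuousLinearMap.toLinearMap
    (continuousLinearMap_ext (F := leftBase M (1 : A)) (G := ContinuousLinearMap.id ℂ _)
      (fun c => by simp [leftBase_base]) fun n x => by simp [leftBase_tensor])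
  θ_mul a b := congrArg ContinuousLinearMap.toLinearMap
    (continuousLinearMap_ext (F := leftBase M (a * b)) (G := (leftBase M a).comp (leftBase M b))
      (fun c => by simp [leftBase_base, mul_assoc]) fun n x => by
        simp [leftBase_tensor, mul_smul])
  γ_smul a x := congrArg ContinuousLinearMap.toLinearMap
    (continuousLinearMap_ext (F := leftGen A (a • x)) (G := (leftBase M a).comp (leftGen A x))
      (fun c => by
        simp only [leftGen_base, ContinuousLinearMap.comp_apply, gen, leftBase_tensor]
        refine congrArg (tensor A 0) (funext fun i => ?_)
        rw [Subsingleton.elim (α := Fin 1) i 0, Function.update_self, ← smul_comm a]) fun n y => by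
        simp [leftGen_tensor, leftBase_tensor])
  γ_op_smul a x := congrArg ContinuousLinearMap.toLinearMap
    (continuousLinearMap_ext (F := leftGen A (MulOpposite.op a • x))
      (G := (leftGen A x).comp (leftBase M a))
      (fun c => by simp [leftGen_base, leftBase_base, mul_smul]) fun n y => by
        simp only [leftGen_tensor, leftBase_tensor, ContinuousLinearMap.comp_apply]
        have key := isBalanced_tensorMap (A := A) (n + 1) (Fin.cons x y) a 0 1 (by simp)
        rw [Fin.update_cons_zero, ← Fin.succ_zero_eq_one, ← Fin.cons_update] at key
        simpa [tensorMap_apply] using key)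
  bound r hr := by
    obtain ⟨q, p, hq, hqp, hle⟩ := exists_isCompatible_seminorm_ge hr
    exact ⟨seminorm q p, continuous_seminorm hq p, hle, q, p, hq, seminorm_leftBase_le hq hqp,
      seminorm_leftGen_le hq hqp⟩

theorem regularRep_θ_apply (a : A) (z : AnalyticTensor A M) :
    (regularRep A M).θ a z = leftBase M a z := rfl

theorem regularRep_γ_apply (x : M) (z : AnalyticTensor A M) :
    (regularRep A M).γ x z = leftGen A x z := rfl

variable {Y : Type*} [AddCommGroup Y] [Module ℂ Y] [UniformSpace Y] [IsUniformAddGroup Y]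
  [PolynormableSpace ℂ Y] [CompleteSpace Y] [T2Space Y] (ρ : AnalyticRep A M Y)

theorem act_leftBase (y : Y) (a : A) (z : AnalyticTensor A M) :
    ρ.act y (leftBase M a z) = ρ.θ a (ρ.act y z) := by
  refine DFunLike.congr_fun (continuousLinearMap_ext
    (F := (ρ.act y).comp (leftBase M a))
    (G := (⟨ρ.θ a, ρ.continuous_θ a⟩ : Y →L[ℂ] Y).comp (ρ.act y)) (fun b => ?_) fun n x => ?_) z
  · simp [leftBase_base, ρ.act_base, ρ.θ_mul]
  · simp only [ContinuousLinearMap.comp_apply, leftBase_tensor, ρ.act_tensor,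
      ContinuousLinearMap.coe_mk', List.ofFn_succ, List.prod_cons, Function.update_self,
      Function.update_of_ne (Fin.succ_ne_zero _), ρ.γ_smul, Module.End.mul_apply]

theorem act_leftGen (y : Y) (x : M) (z : AnalyticTensor A M) :
    ρ.act y (leftGen A x z) = ρ.γ x (ρ.act y z) := by
  refine DFunLike.congr_fun (continuousLinearMap_ext
    (F := (ρ.act y).comp (leftGen A x))
    (G := (⟨ρ.γ x, ρ.continuous_γ x⟩ : Y →L[ℂ] Y).comp (ρ.act y)) (fun b => ?_) fun n w => ?_) z
  · simp [leftGen_base, ρ.act_base, ρ.act_gen, ρ.γ_op_smul]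
  · simp [leftGen_tensor, ρ.act_tensor]

theorem act_prod_leftGen (y : Y) (z : AnalyticTensor A M) {n : ℕ} (x : Fin n → M) :
    ρ.act y ((List.ofFn fun i => (regularRep A M).γ (x i)).prod z) =
      (List.ofFn fun i => ρ.γ (x i)).prod (ρ.act y z) := by
  induction n with
  | zero => simp
  | succ n ih =>
    simp only [List.ofFn_succ, List.prod_cons, Module.End.mul_apply, regularRep_γ_apply,
      act_leftGen]
    exact congrArg _ (ih fun i => x i.succ)

/-- Representations are multiplicative. -/
theorem act_act (y : Y) (z w : AnalyticTensor A M) :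
    ρ.act y ((regularRep A M).act w z) = ρ.act (ρ.act y w) z := by
  refine DFunLike.congr_fun (continuousLinearMap_ext
    (F := (ρ.act y).comp ((regularRep A M).act w)) (G := ρ.act (ρ.act y w))
    (fun a => ?_) fun n x => ?_) z
  · rw [ContinuousLinearMap.comp_apply, AnalyticRep.act_base, regularRep_θ_apply, act_leftBase,
      AnalyticRep.act_base]
  · rw [ContinuousLinearMap.comp_apply, AnalyticRep.act_tensor, act_prod_leftGen,
      AnalyticRep.act_tensor]

theorem prod_leftGen_one (n : ℕ) (x : Fin (n + 1) → M) :
    (List.ofFn fun i => (regularRep A M).γ (x i)).prod (base A 1) = tensor A n x := by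
  induction n with
  | zero =>
    have : (List.ofFn fun i => (regularRep A M).γ (x i)).prod (base A 1) =
        leftGen A (x 0) (base A 1) := by simp [regularRep_γ_apply]
    rw [this, leftGen_base, MulOpposite.op_one, one_smul]
    exact congrArg (tensor A 0) (funext fun i => by rw [Subsingleton.elim (α := Fin 1) i 0])
  | succ n ih =>
    rw [List.ofFn_succ, List.prod_cons, Module.End.mul_apply, ih fun i => x i.succ,
      regularRep_γ_apply, leftGen_tensor]
    exact congrArg (tensor A (n + 1)) (Fin.cons_self_tail x)

theorem act_one (z : AnalyticTensor A M) : (regularRep A M).act (base A 1) z = z := by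
  refine DFunLike.congr_fun (continuousLinearMap_ext
    (F := (regularRep A M).act (base A 1)) (G := ContinuousLinearMap.id ℂ _)
    (fun a => ?_) fun n x => ?_) z
  · rw [AnalyticRep.act_base, regularRep_θ_apply, leftBase_base, mul_one,
      ContinuousLinearMap.id_apply]
  · rw [AnalyticRep.act_tensor, prod_leftGen_one, ContinuousLinearMap.id_apply]

end Regular

end AnalyticTensor

/-- The underlying space of the analytic tensor algebra, to be equipped with the multiplication. -/
def AnalyticTensorAlgebra (A M : Type*) [Ring A]
    [AddCommGroup M] [Module ℂ M] [Module A M] [Module Aᵐᵒᵖ M] [TopologicalSpace M] : Type _ :=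
  AnalyticTensor A M

namespace AnalyticTensorAlgebra

variable (A M : Type*) [Ring A] [Algebra ℂ A] [UniformSpace A] [ArensMichaelAlgebra A]
  [AddCommGroup M] [Module ℂ M] [Module A M] [Module Aᵐᵒᵖ M] [UniformSpace M] [HatBimodule A M]

instance : AddCommGroup (AnalyticTensorAlgebra A M) :=
  inferInstanceAs (AddCommGroup (AnalyticTensor A M))

instance : Module ℂ (AnalyticTensorAlgebra A M) :=
  inferInstanceAs (Module ℂ (AnalyticTensor A M))

instance : UniformSpace (AnalyticTensorAlgebra A M) :=
  inferInstanceAs (UniformSpace (AnalyticTensor A M))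

instance : IsUniformAddGroup (AnalyticTensorAlgebra A M) :=
  inferInstanceAs (IsUniformAddGroup (AnalyticTensor A M))

instance : CompleteSpace (AnalyticTensorAlgebra A M) :=
  inferInstanceAs (CompleteSpace (AnalyticTensor A M))

instance : T2Space (AnalyticTensorAlgebra A M) :=
  inferInstanceAs (T2Space (AnalyticTensor A M))

/-- The identification of the space `T̂_A(M)` with the algebra. -/
def equiv : AnalyticTensor A M ≃L[ℂ] AnalyticTensorAlgebra A M := ContinuousLinearEquiv.refl ℂ _

instance : Mul (AnalyticTensorAlgebra A M) :=
  ⟨fun z w => equiv A M ((AnalyticTensor.regularRep A M).act ((equiv A M).symm w)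
    ((equiv A M).symm z))⟩

instance : One (AnalyticTensorAlgebra A M) := ⟨equiv A M (AnalyticTensor.base A 1)⟩

variable {A M}

omit [ArensMichaelAlgebra A] [HatBimodule A M] in
theorem one_eq : (1 : AnalyticTensorAlgebra A M) = equiv A M (AnalyticTensor.base A 1) := rfl

instance : Ring (AnalyticTensorAlgebra A M) where
  __ := (inferInstance : AddCommGroup (AnalyticTensorAlgebra A M))
  left_distrib z w u := (AnalyticTensor.regularRep A M).act_add _ _ _
  right_distrib z w u := map_add ((AnalyticTensor.regularRep A M).act _) _ _
  zero_mul w := map_zero ((AnalyticTensor.regularRep A M).act _)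
  mul_zero z := by
    have := (AnalyticTensor.regularRep A M).act_smul 0 0 z
    rw [zero_smul, zero_smul] at this
    exact this
  mul_assoc z w u := AnalyticTensor.act_act (AnalyticTensor.regularRep A M) u z w
  one_mul w := ((AnalyticTensor.regularRep A M).act_base w 1).trans (by
    rw [(AnalyticTensor.regularRep A M).θ_one]
    rfl)
  mul_one z := AnalyticTensor.act_one z

instance : Algebra ℂ (AnalyticTensorAlgebra A M) :=
  Algebra.ofModule (fun c z w => map_smul ((AnalyticTensor.regularRep A M).act w) c z)
    fun c z w => (AnalyticTensor.regularRep A M).act_smul c w z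

theorem base_mul (a : A) (z : AnalyticTensor A M) :
    equiv A M (AnalyticTensor.base A a) * equiv A M z =
      equiv A M (AnalyticTensor.leftBase M a z) :=
  (AnalyticTensor.regularRep A M).act_base z a

theorem gen_mul (x : M) (z : AnalyticTensor A M) :
    equiv A M (AnalyticTensor.gen A x) * equiv A M z = equiv A M (AnalyticTensor.leftGen A x z) :=
  (AnalyticTensor.regularRep A M).act_gen z x

variable (A M) in
theorem isAnalyticTensorAlgebra : IsAnalyticTensorAlgebra (equiv A M) where
  map_one := rfl
  map_mul a b := by rw [base_mul, AnalyticTensor.leftBase_base]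
  map_smul a x := by
    rw [base_mul, AnalyticTensor.gen, AnalyticTensor.gen, AnalyticTensor.leftBase_tensor]
    refine congrArg (fun x => equiv A M (AnalyticTensor.tensor A 0 x)) (funext fun i => ?_)
    rw [Subsingleton.elim (α := Fin 1) i 0, Function.update_self]
  map_op_smul a x := by rw [gen_mul, AnalyticTensor.leftGen_base]
  map_tensor n x := by
    rw [← AnalyticTensor.prod_leftGen_one]
    have key {n : ℕ} (x : Fin n → M) : equiv A M
        ((List.ofFn fun i => (AnalyticTensor.regularRep A M).γ (x i)).prod
          (AnalyticTensor.base A 1)) =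
        (List.ofFn fun i => equiv A M (AnalyticTensor.gen A (x i))).prod := by
      induction n with
      | zero => simp [one_eq]
      | succ n ih =>
        rw [List.ofFn_succ, List.prod_cons, Module.End.mul_apply, List.ofFn_succ, List.prod_cons,
          ← ih fun i => x i.succ, gen_mul]
        rfl
    exact key x

variable (A M) in
theorem arensMichaelAlgebra : ArensMichaelAlgebra (AnalyticTensorAlgebra A M) := by
  refine ArensMichaelAlgebra.of_submultiplicative fun U hU => ?_
  have hU' : equiv A M ⁻¹' U ∈ 𝓝 (0 : AnalyticTensor A M) := hU
  obtain ⟨r, hr, hrU⟩ := exists_continuous_seminorm_of_mem_nhds hU'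
  obtain ⟨q, p, hq, hqp, hle⟩ := AnalyticTensor.exists_isCompatible_seminorm_ge hr
  refine ⟨(AnalyticTensor.seminorm q p).comp (equiv A M).symm.toLinearMap,
    AnalyticTensor.continuous_seminorm hq p, fun z w => ?_,
    fun x hx => hrU x ((hle x).trans_lt hx)⟩
  rw [mul_comm]
  exact (AnalyticTensor.regularRep A M).seminorm_act_le (AnalyticTensor.continuous_seminorm hq p)
    (AnalyticTensor.seminorm_leftBase_le hq hqp) (AnalyticTensor.seminorm_leftGen_le hq hqp) _ _

end AnalyticTensorAlgebra

section Countability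

theorem exists_seq_continuous_seminorm (E : Type*) [AddCommGroup E] [Module ℂ E]
    [TopologicalSpace E] [FirstCountableTopology E] [PolynormableSpace ℂ E] :
    ∃ p : ℕ → {p : Seminorm ℂ E // Continuous p},
      ∀ r : Seminorm ℂ E, Continuous r → ∃ k, ∀ x, r x ≤ (p k).1 x := by
  obtain ⟨U, hU⟩ := (𝓝 (0 : E)).exists_antitone_basis
  choose p hp hpU using fun k => exists_continuous_seminorm_of_mem_nhds (hU.mem k)
  refine ⟨fun k => ⟨p k, hp k⟩, fun r hr => ?_⟩
  obtain ⟨k, hk⟩ := hU.mem_iff.1 (hr.continuousAt.preimage_mem_nhds (t := Set.Iio 1)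
    (by simpa using Iio_mem_nhds one_pos))
  exact ⟨k, Seminorm.le_of_forall_lt_one fun x hx => hk (hpU k x hx)⟩

instance (A M : Type*) [Ring A] [AddCommGroup M] [Module ℂ M] [Module A M] [Module Aᵐᵒᵖ M]
    [TopologicalSpace M] [FirstCountableTopology M] [PolynormableSpace ℂ M] :
    FirstCountableTopology (AnalyticTensorPos A M) := by
  obtain ⟨p, hp⟩ := exists_seq_continuous_seminorm M
  have h : WithSeminorms fun k => AnalyticTensorPos.seminorm A M (p k, ⟨1, one_pos⟩) := by
    refine (SeminormFamily.withSeminorms_iff_nhds_eq_iInf _).2 (le_antisymm ?_ fun U hU => ?_)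
    · refine le_iInf fun k => Filter.map_le_iff_le_comap.1 ?_
      have := ((AnalyticTensorPos.withSeminorms A M).continuous_seminorm
        (p k, ⟨1, one_pos⟩)).tendsto 0
      rwa [map_zero] at this
    · obtain ⟨r, hr, hrU⟩ := exists_continuous_seminorm_of_mem_nhds hU
      obtain ⟨p', hp'⟩ := AnalyticTensorPos.exists_seminorm_ge hr
      obtain ⟨k, hk⟩ := hp p'.1 p'.2
      refine Filter.mem_iInf_of_mem k (Filter.mem_of_superset
        (Filter.preimage_mem_comap (Iio_mem_nhds one_pos)) fun t ht => hrU t ?_)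
      refine (hp' t).trans_lt (lt_of_le_of_lt ?_ ht)
      rw [← one_mul (AnalyticTensorPos.seminorm A M (p', _) t)]
      exact AnalyticTensorPos.mul_seminorm_le le_rfl (fun x => by simpa using hk x) t
  exact h.firstCountableTopology

end Countability

section Quotient

theorem exists_arensMichael_quotient.{s} {T : Type s} [Ring T] [Algebra ℂ T] [UniformSpace T]
    [ArensMichaelAlgebra T] [FirstCountableTopology T] (J : TwoSidedIdeal T) :
    ∃ (L : Type s) (_ : Ring L) (_ : Algebra ℂ L) (_ : UniformSpace L) (π : T →A[ℂ] L),
      ArensMichaelAlgebra L ∧ Topology.IsQuotientMap π ∧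
        ∀ t : T, π t = 0 ↔ t ∈ closure (J : Set T) := by
  let I : Ideal T := J.asIdeal.closure
  have hI : I.IsTwoSided := ⟨fun b ha =>
    map_mem_closure (f := fun x => x * b) (continuous_mul_const b) ha
      fun x hx => J.mul_mem_right x b hx⟩
  let _ : TopologicalSpace (T ⧸ I) := inferInstanceAs (TopologicalSpace (T ⧸ I.toAddSubgroup))
  have hgroup : IsTopologicalAddGroup (T ⧸ I) :=
    inferInstanceAs (IsTopologicalAddGroup (T ⧸ I.toAddSubgroup))
  let _ : UniformSpace (T ⧸ I) := IsTopologicalAddGroup.rightUniformSpace (T ⧸ I)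
  have : IsUniformAddGroup (T ⧸ I) := isUniformAddGroup_of_addCommGroup
  have : CompleteSpace (T ⧸ I) := QuotientAddGroup.completeSpace_right T I.toAddSubgroup
  have hclosed : IsClosed (I.toAddSubgroup : Set T) := isClosed_closure
  have : T3Space (T ⧸ I) := inferInstanceAs (T3Space (T ⧸ I.toAddSubgroup))
  let π : T →ₐ[ℂ] T ⧸ I := Ideal.Quotient.mkₐ ℂ I
  have hπ : Topology.IsQuotientMap π := isQuotientMap_quot_mk
  have hπs : Function.Surjective π := hπ.surjective
  have hspan : Submodule.span ℂ (Set.range π) = ⊤ := by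
    rw [hπs.range_eq, Submodule.span_univ]
  refine ⟨T ⧸ I, inferInstance, inferInstance, inferInstance, ⟨π, hπ.continuous⟩,
    .of_submultiplicative fun U hU => ?_, hπ, fun t => Ideal.Quotient.eq_zero_iff_mem⟩
  obtain ⟨r, hr, hrU⟩ := exists_continuous_seminorm_of_mem_nhds
    (hπ.continuous.continuousAt.preimage_mem_nhds (x := (0 : T)) (by rwa [map_zero]))
  obtain ⟨q, hq, hqs, hle⟩ := ArensMichaelAlgebra.exists_submultiplicative_ge hr
  let s : Seminorm ℂ (T ⧸ I) := infSeminorm π q (apply_nonneg q) hspan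
  have hs (t : T) : s (π t) ≤ q t := infSeminorm_apply_le t
  have hmul (z : T ⧸ I) (t : T) : s (z * π t) ≤ q t * s z :=
    le_mul_infSeminorm (s.comp (LinearMap.mulRight ℂ (π t))) (apply_nonneg q t) (fun u => by
      rw [Seminorm.comp_apply, LinearMap.mulRight_apply, ← map_mul, mul_comm]
      exact (hs _).trans (hqs u t)) z
  refine ⟨s, hπ.continuous_iff.2 ?_, fun z w => ?_, fun z hz => ?_⟩
  · exact continuous_seminorm_of_le (p := s.comp π.toLinearMap) hq hs
  · exact le_mul_infSeminorm (s.comp (LinearMap.mulLeft ℂ z)) (apply_nonneg s z) (fun t => by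
      rw [Seminorm.comp_apply, LinearMap.mulLeft_apply, mul_comm]
      exact hmul z t) w
  · obtain ⟨f, rfl, hf⟩ := infSeminorm_lt_iff_exists hz
    have hlin : Finsupp.linearCombination ℂ π f =
        π (Finsupp.linearCombination ℂ (id : T → T) f) := by
      simp [Finsupp.linearCombination_apply, Finsupp.sum, map_sum]
    rw [hlin]
    refine hrU _ ((hle _).trans_lt (lt_of_le_of_lt ?_ hf))
    have := seminorm_linearCombination_le (t := (id : T → T)) (c := q) q (C := 1)
      (fun x => by simp) f
    rwa [one_mul] at this

end Quotient

section Induced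

variable {A M B : Type*} [Ring A] [Algebra ℂ A] [UniformSpace A]
  [AddCommGroup M] [Module ℂ M] [Module A M] [Module Aᵐᵒᵖ M]
  [Ring B] [Algebra ℂ B] [UniformSpace B] [ArensMichaelAlgebra B]

/-- The representation by left multiplication on an Arens–Michael algebra which is induced by a
homomorphism on `A` and a compatible bimodule homomorphism on `M`. -/
def AnalyticRep.ofHom [TopologicalSpace M] (θ : A →A[ℂ] B) (γ : M →L[ℂ] B)
    (h : ∀ (a : A) (x : M), γ (a • x) = θ a * γ x)
    (h' : ∀ (a : A) (x : M), γ (MulOpposite.op a • x) = γ x * θ a) : AnalyticRep A M B where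
  θ := (Algebra.lmul ℂ B).toLinearMap ∘ₗ (θ : A →ₐ[ℂ] B).toLinearMap
  γ := (Algebra.lmul ℂ B).toLinearMap ∘ₗ γ.toLinearMap
  θ_one := LinearMap.ext fun b => by simp
  θ_mul a b := LinearMap.ext fun b => by simp [mul_assoc]
  γ_smul a x := LinearMap.ext fun b => by simp [h, mul_assoc]
  γ_op_smul a x := LinearMap.ext fun b => by simp [h', mul_assoc]
  bound r hr := by
    obtain ⟨q, hq, hqs, hle⟩ := ArensMichaelAlgebra.exists_submultiplicative_ge hr
    exact ⟨q, hq, hle, q.comp (θ : A →ₐ[ℂ] B).toLinearMap,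
      ⟨q.comp γ.toLinearMap, hq.comp γ.continuous⟩, hq.comp θ.continuous, fun a y => hqs _ _,
      fun x y => hqs _ _⟩

variable [ArensMichaelAlgebra A] [UniformSpace M] [HatBimodule A M]

/-- The analytic tensor algebra has the universal property of the tensor algebra with respect to
Arens–Michael algebras. -/
theorem AnalyticTensorAlgebra.exists_lift (θ : A →A[ℂ] B) (γ : M →L[ℂ] B)
    (h : ∀ (a : A) (x : M), γ (a • x) = θ a * γ x)
    (h' : ∀ (a : A) (x : M), γ (MulOpposite.op a • x) = γ x * θ a) :
    ∃ F : AnalyticTensorAlgebra A M →A[ℂ] B,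
      (∀ a, F (AnalyticTensorAlgebra.equiv A M (AnalyticTensor.base A a)) = θ a) ∧
      ∀ x, F (AnalyticTensorAlgebra.equiv A M (AnalyticTensor.gen A x)) = γ x := by
  let ρ := AnalyticRep.ofHom θ γ h h'
  have hθ (a : A) (b : B) : ρ.θ a b = θ a * b := rfl
  have hγ (x : M) (b : B) : ρ.γ x b = γ x * b := rfl
  have hword {n : ℕ} (x : Fin n → M) (b : B) : (List.ofFn fun i => ρ.γ (x i)).prod b =
      (List.ofFn fun i => ρ.γ (x i)).prod 1 * b := by
    induction n with
    | zero => simp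
    | succ n ih =>
      simp only [List.ofFn_succ, List.prod_cons, Module.End.mul_apply, hγ]
      rw [ih fun i => x i.succ, mul_assoc]
  have hact (z : AnalyticTensor A M) (b : B) : ρ.act b z = ρ.act 1 z * b :=
    DFunLike.congr_fun (AnalyticTensor.continuousLinearMap_ext (F := ρ.act b)
      (G := (⟨LinearMap.mulRight ℂ b, continuous_mul_const b⟩ : B →L[ℂ] B).comp (ρ.act 1))
      (fun a => by simp [ρ.act_base, hθ]; rfl)
      fun n x => by
        rw [ContinuousLinearMap.comp_apply, ρ.act_tensor, ρ.act_tensor]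
        exact hword x b) z
  refine ⟨⟨AlgHom.ofLinearMap ((ρ.act 1).toLinearMap ∘ₗ
      (AnalyticTensorAlgebra.equiv A M).symm.toLinearMap) ?_ fun z w => ?_, ?_⟩,
    fun a => ?_, fun x => ?_⟩
  · exact (ρ.act_base 1 1).trans (by rw [hθ, map_one, mul_one])
  · exact (AnalyticTensor.act_act ρ 1 z w).trans (hact _ _)
  · exact (ρ.act 1).continuous
  · exact (ρ.act_base 1 a).trans (by rw [hθ, mul_one])
  · exact (ρ.act_gen 1 x).trans (by rw [hγ, mul_one])

theorem AnalyticTensorAlgebra.hom_ext {f g : AnalyticTensorAlgebra A M →A[ℂ] B}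
    (h₀ : ∀ a, f (equiv A M (AnalyticTensor.base A a)) = g (equiv A M (AnalyticTensor.base A a)))
    (h : ∀ x, f (equiv A M (AnalyticTensor.gen A x)) = g (equiv A M (AnalyticTensor.gen A x))) :
    f = g := by
  have key := AnalyticTensor.continuousLinearMap_ext
    (F := f.toContinuousLinearMap.comp (equiv A M).toContinuousLinearMap)
    (G := g.toContinuousLinearMap.comp (equiv A M).toContinuousLinearMap) h₀ fun n x => by
      have hf (f : AnalyticTensorAlgebra A M →A[ℂ] B) : f (equiv A M (AnalyticTensor.tensor A n x)) =
          (List.ofFn fun i => f (equiv A M (AnalyticTensor.gen A (x i)))).prod := by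
        rw [(isAnalyticTensorAlgebra A M).map_tensor, map_list_prod, List.map_ofFn]
        rfl
      change f (equiv A M _) = g (equiv A M _)
      rw [hf, hf]
      simp only [h]
  exact DFunLike.ext _ _ fun z => DFunLike.congr_fun key ((equiv A M).symm z)

variable (A) in
/-- The elements of degree one as a continuous linear map. -/
def AnalyticTensor.genL : M →L[ℂ] AnalyticTensor A M where
  toFun := gen A
  map_add' := gen_add
  map_smul' := gen_smul
  cont := by
    have := HatBimodule.isUniformAddGroup A (M := M)
    have := HatBimodule.continuousSMul A (M := M)
    refine continuous_of_forall_seminorm_le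
      { toFun := gen A, map_add' := gen_add, map_smul' := gen_smul }
      fun r hr => ?_
    obtain ⟨q, p, hq, hqp, hle⟩ := exists_isCompatible_seminorm_ge hr
    refine ⟨1, p.1, p.2, fun x => (hle _).trans ?_⟩
    rw [one_mul]
    exact (seminorm_tensor_le q p 0 _).trans (by rw [Fin.prod_univ_one])

end Induced

section Laurent

variable {A M N : Type*} [Ring A] [Algebra ℂ A] [UniformSpace A] [ArensMichaelAlgebra A]
  [AddCommGroup M] [Module ℂ M] [Module A M] [Module Aᵐᵒᵖ M] [UniformSpace M] [HatBimodule A M]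
  [AddCommGroup N] [Module ℂ N] [Module A N] [Module Aᵐᵒᵖ N] [UniformSpace N] [HatBimodule A N]

open AnalyticTensorAlgebra

theorem AnalyticTensorAlgebra.equiv_tensor_pair (x y : M) :
    equiv A M (AnalyticTensor.tensor A 1 ![x, y]) =
      equiv A M (AnalyticTensor.gen A x) * equiv A M (AnalyticTensor.gen A y) := by
  rw [(isAnalyticTensorAlgebra A M).map_tensor]
  simp

variable {h : TopologicallyInverse A M N} {L : Type*} [Ring L] [Algebra ℂ L] [UniformSpace L]

/-- The compatible triple given by a homomorphism of the analytic tensor algebra that kills the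
defining relations of the Laurent algebra. -/
def CompatibleTriple.ofHom (π : AnalyticTensorAlgebra A (M × N) →A[ℂ] L)
    (hπ : ∀ z ∈ laurentRelations h, π (equiv A (M × N) z) = 0) : CompatibleTriple h L where
  θ :=
    { toFun := fun a => π (equiv A (M × N) (AnalyticTensor.base A a))
      map_one' := map_one π
      map_mul' := fun a b => by
        rw [(isAnalyticTensorAlgebra A (M × N)).map_mul, map_mul]
      map_zero' := (map_zero π :)
      map_add' := fun a b => by rw [AnalyticTensor.base_add, map_add, map_add]
      commutes' := fun c => by
        rw [Algebra.algebraMap_eq_smul_one, AnalyticTensor.base_smul,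
          Algebra.algebraMap_eq_smul_one, ← map_one π]
        exact map_smul π c 1
      cont := π.continuous.comp
        ((equiv A (M × N)).continuous.comp (continuous_id.prodMk continuous_const)) }
  α := π.toContinuousLinearMap ∘L (equiv A (M × N)).toContinuousLinearMap ∘L
    AnalyticTensor.genL A ∘L ContinuousLinearMap.inl ℂ M N
  β := π.toContinuousLinearMap ∘L (equiv A (M × N)).toContinuousLinearMap ∘L
    AnalyticTensor.genL A ∘L ContinuousLinearMap.inr ℂ M N
  α_smul a x := by
    have := congrArg π ((isAnalyticTensorAlgebra A (M × N)).map_smul a (x, 0))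
    rw [map_mul, Prod.smul_mk, smul_zero] at this
    exact this
  α_op_smul a x := by
    have := congrArg π ((isAnalyticTensorAlgebra A (M × N)).map_op_smul a (x, 0))
    rw [map_mul, Prod.smul_mk, smul_zero] at this
    exact this
  β_smul a y := by
    have := congrArg π ((isAnalyticTensorAlgebra A (M × N)).map_smul a (0, y))
    rw [map_mul, Prod.smul_mk, smul_zero] at this
    exact this
  β_op_smul a y := by
    have := congrArg π ((isAnalyticTensorAlgebra A (M × N)).map_op_smul a (0, y))
    rw [map_mul, Prod.smul_mk, smul_zero] at this
    exact this
  compat₁ x y := by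
    have := hπ _ ⟨x, y, Or.inl rfl⟩
    rw [map_sub, map_sub, sub_eq_zero, equiv_tensor_pair, map_mul] at this
    exact this
  compat₂ y x := by
    have := hπ _ ⟨x, y, Or.inr rfl⟩
    rw [map_sub, map_sub, sub_eq_zero, equiv_tensor_pair, map_mul] at this
    exact this

/-- A compatible triple extends to the analytic tensor algebra, and the extension kills the
defining relations of the Laurent algebra. -/
theorem CompatibleTriple.exists_lift {B : Type*} [Ring B] [Algebra ℂ B] [UniformSpace B]
    [ArensMichaelAlgebra B] (σ : CompatibleTriple h B) :
    ∃ F : AnalyticTensorAlgebra A (M × N) →A[ℂ] B,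
      (∀ a, F (equiv A (M × N) (AnalyticTensor.base A a)) = σ.θ a) ∧
      (∀ x, F (equiv A (M × N) (AnalyticTensor.gen A (x, 0))) = σ.α x) ∧
      (∀ y, F (equiv A (M × N) (AnalyticTensor.gen A (0, y))) = σ.β y) ∧
      ∀ z ∈ laurentRelations h, F (equiv A (M × N) z) = 0 := by
  obtain ⟨F, hθ, hγ⟩ := AnalyticTensorAlgebra.exists_lift σ.θ (σ.α.coprod σ.β)
    (fun a z => by simp [σ.α_smul, σ.β_smul, mul_add])
    (fun a z => by simp [σ.α_op_smul, σ.β_op_smul, add_mul])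
  have hα (x : M) : F (equiv A (M × N) (AnalyticTensor.gen A (x, 0))) = σ.α x := by
    simp [hγ]
  have hβ (y : N) : F (equiv A (M × N) (AnalyticTensor.gen A (0, y))) = σ.β y := by
    simp [hγ]
  refine ⟨F, hθ, hα, hβ, ?_⟩
  rintro z ⟨x, y, rfl | rfl⟩
  · rw [map_sub, map_sub, sub_eq_zero, equiv_tensor_pair, map_mul, hα, hβ, hθ, σ.compat₁]
  · rw [map_sub, map_sub, sub_eq_zero, equiv_tensor_pair, map_mul, hα, hβ, hθ, σ.compat₂]

end Laurent

/-- A continuous homomorphism factors through a quotient homomorphism if it vanishes on a set which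
generates the kernel as a closed two-sided ideal. -/
theorem exists_factor_of_isQuotientMap {T L B : Type*} [Ring T] [Algebra ℂ T] [TopologicalSpace T]
    [Ring L] [Algebra ℂ L] [TopologicalSpace L] [Ring B] [Algebra ℂ B] [TopologicalSpace B]
    [T1Space B] {π : T →A[ℂ] L} (hπ : Topology.IsQuotientMap π) {S : Set T}
    (hker : ∀ t, π t = 0 ↔ t ∈ closure (TwoSidedIdeal.span S : Set T)) (F : T →A[ℂ] B)
    (hF : ∀ s ∈ S, F s = 0) : ∃ f : L →A[ℂ] B, ∀ t, f (π t) = F t := by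
  have hle : TwoSidedIdeal.span S ≤ TwoSidedIdeal.ker F :=
    TwoSidedIdeal.span_le.2 fun s hs => (TwoSidedIdeal.mem_ker F).2 (hF s hs)
  have hzero (t : T) (ht : π t = 0) : F t = 0 :=
    closure_minimal (t := F ⁻¹' {0}) (fun s hs => (TwoSidedIdeal.mem_ker F).1 (hle hs))
      (isClosed_singleton.preimage F.continuous) ((hker t).1 ht)
  let g := Function.surjInv hπ.surjective
  have hf (t : T) : F (g (π t)) = F t := by
    rw [← sub_eq_zero, ← map_sub]
    exact hzero _ (by rw [map_sub, Function.surjInv_eq hπ.surjective, sub_self])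
  have hmap {z w : L} (op : T → T → T) (op' : L → L → L) (h : ∀ s t, π (op s t) = op' (π s) (π t)) :
      F (g (op' z w)) = F (op (g z) (g w)) := by
    rw [← hf (op _ _), h, Function.surjInv_eq hπ.surjective, Function.surjInv_eq hπ.surjective]
  refine ⟨⟨{ toFun := fun z => F (g z), map_one' := ?_, map_mul' := fun z w => ?_,
             map_zero' := ?_, map_add' := fun z w => ?_, commutes' := fun c => ?_ },
      hπ.continuous_iff.2 (F.continuous.congr fun t => (hf t).symm)⟩, hf⟩
  · simpa using hf 1
  · rw [hmap (· * ·) (· * ·) (map_mul π), map_mul]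
  · simpa using hf 0
  · rw [hmap (· + ·) (· + ·) (map_add π), map_add]
  · have hπc : π (algebraMap ℂ T c) = algebraMap ℂ L c := (π : T →ₐ[ℂ] L).commutes c
    have hFc : F (algebraMap ℂ T c) = algebraMap ℂ B c := (F : T →ₐ[ℂ] B).commutes c
    exact hπc ▸ (hf _).trans hFc

end HatTensor

end

theorem theorem2p2
    {A : Type u} [Ring A] [Algebra ℂ A] [UniformSpace A] [ArensMichaelAlgebra A]
    [TopologicalSpace.MetrizableSpace A]
    {M : Type v} [AddCommGroup M] [Module ℂ M] [Module A M] [Module Aᵐᵒᵖ M] [UniformSpace M]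
    [HatBimodule A M] [TopologicalSpace.MetrizableSpace M]
    {N : Type w} [AddCommGroup N] [Module ℂ N] [Module A N] [Module Aᵐᵒᵖ N] [UniformSpace N]
    [HatBimodule A N] [TopologicalSpace.MetrizableSpace N]
    (h : HatTensor.TopologicallyInverse A M N) :
    -- the analytic tensor algebra of `M ⊕ N`
    ∃ (T : Type max u v w) (_ : Ring T) (_ : Algebra ℂ T) (_ : UniformSpace T)
      (e : HatTensor.AnalyticTensor A (M × N) ≃L[ℂ] T),
      ArensMichaelAlgebra T ∧ HatTensor.IsAnalyticTensorAlgebra e ∧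
    -- its quotient by the closed two-sided ideal generated by the relations
    ∃ (L : Type max u v w) (_ : Ring L) (_ : Algebra ℂ L) (_ : UniformSpace L)
      (π : T →A[ℂ] L),
      ArensMichaelAlgebra L ∧ Topology.IsQuotientMap π ∧
      (∀ t : T, π t = 0 ↔
        t ∈ closure (TwoSidedIdeal.span (e '' HatTensor.laurentRelations h) : Set T)) ∧
    -- the compatible triple and its universal property
    ∃ τ : HatTensor.CompatibleTriple h L,
      (∀ a : A, τ.θ a = π (e (HatTensor.AnalyticTensor.base A a))) ∧
      (∀ x : M, τ.α x = π (e (HatTensor.AnalyticTensor.gen A (x, 0)))) ∧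
      (∀ y : N, τ.β y = π (e (HatTensor.AnalyticTensor.gen A (0, y)))) ∧
      ∀ (B : Type z) [Ring B] [Algebra ℂ B] [UniformSpace B] [ArensMichaelAlgebra B]
        (σ : HatTensor.CompatibleTriple h B),
        ∃! f : L →A[ℂ] B, (∀ a : A, f (τ.θ a) = σ.θ a) ∧
          (∀ x : M, f (τ.α x) = σ.α x) ∧ (∀ y : N, f (τ.β y) = σ.β y) := by
  have := HatBimodule.locallyConvex A (M := M)
  have := HatBimodule.locallyConvex A (M := N)
  have : FirstCountableTopology (HatTensor.AnalyticTensorAlgebra A (M × N)) :=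
    inferInstanceAs (FirstCountableTopology (HatTensor.AnalyticTensor A (M × N)))
  have hT := HatTensor.AnalyticTensorAlgebra.arensMichaelAlgebra A (M × N)
  refine ⟨HatTensor.AnalyticTensorAlgebra A (M × N), inferInstance, inferInstance, inferInstance,
    HatTensor.AnalyticTensorAlgebra.equiv A (M × N), hT,
    HatTensor.AnalyticTensorAlgebra.isAnalyticTensorAlgebra A (M × N), ?_⟩
  obtain ⟨L, _, _, _, π, hL, hπ, hker⟩ := HatTensor.exists_arensMichael_quotient
    (TwoSidedIdeal.span
      (HatTensor.AnalyticTensorAlgebra.equiv A (M × N) '' HatTensor.laurentRelations h))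
  refine ⟨L, inferInstance, inferInstance, inferInstance, π, hL, hπ, hker,
    .ofHom π fun z hz => (hker _).2 (subset_closure
      (TwoSidedIdeal.subset_span (Set.mem_image_of_mem _ hz))),
    fun a => rfl, fun x => rfl, fun y => rfl, fun B _ _ _ _ σ => ?_⟩
  obtain ⟨F, hθ, hα, hβ, hF⟩ := σ.exists_lift
  obtain ⟨f, hf⟩ := HatTensor.exists_factor_of_isQuotientMap hπ hker F
    (by rintro _ ⟨z, hz, rfl⟩; exact hF z hz)
  refine ⟨f, ⟨fun a => (hf _).trans (hθ a), fun x => (hf _).trans (hα x),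
    fun y => (hf _).trans (hβ y)⟩, fun g ⟨gθ, gα, gβ⟩ => ?_⟩
  have key : g.comp π = F := by
    refine HatTensor.AnalyticTensorAlgebra.hom_ext (fun a => (gθ a).trans (hθ a).symm)
      fun z => ?_
    have hz : z = (z.1, 0) + (0, z.2) := by simp
    rw [hz, HatTensor.AnalyticTensor.gen_add, map_add, map_add, map_add]
    exact congrArg₂ (· + ·) ((gα z.1).trans (hα z.1).symm) ((gβ z.2).trans (hβ z.2).symm)
  refine DFunLike.ext _ _ fun l => ?_
  obtain ⟨t, rfl⟩ := hπ.surjective l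
  rw [hf, ← key]
  rfl
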